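/- Conventions. Let $M$ be a smooth manifold, $V\to M$ a smooth real vector bundle of finite rank, $\nabla$ a smooth connection on $V$, and $\pi\colon X=\mathrm{tot}(V)\to M$ the total space. For a vector bundle $W$, the bundle $W\oplus W^\vee$ carries the pairing $\langle v+f,w+g\rangle=-\tfrac12(f(w)+g(v))$, and a generalized almost complex structure on $W$ is a smooth bundle automorphism of $W\oplus W^\vee$ that preserves the pairing and squares to $-1$. A generalized almost complex structure $\mathcal J$ on a manifold $Y$ is one on the bundle $T_Y$; it is integrable (a generalized complex structure) if the sheaf of sections of its $+i$-eigenbundle in $(T_Y\oplus T_Y^\vee)\otimes\mathbb C$ is closed under the Courant bracket $$[A+\xi,B+\eta]=[A,B]+\mathcal L_A\eta-\mathcal L_B\xi+\tfrac12\,d(\iota_B\xi-\iota_A\eta).$$ An almost Dirac structure on $M$ is a maximally isotropic smooth subbundle of $T_M\oplus T_M^\vee$; it is a Dirac structure (integrable) if its sheaf of sections is closed under the Courant bracket. Let $j\colon\pi^*V\to T_X$ be the vertical inclusion, $D\colon T_X\to\pi^*V$ the projection $D=(\pi^*\nabla)(S)$, where $S$ is the tautological section of $\pi^*V$, and $\alpha\colon\pi^*T_M\to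 T_X$ the horizontal lift, with $d\pi\circ\alpha=1$ and $D\circ\alpha=0$. They give an isomorphism $$F\colon T_X\oplus T_X^\vee\to\pi^*(V\oplus T_M\oplus V^\vee\oplus T_M^\vee),\qquad F(w+\xi)=\bigl(D(w),\,d\pi(w),\,j^\vee\xi,\,\alpha^\vee\xi\bigr).$$ Suppose that $\nabla$ is flat. A generalized almost complex structure $\mathcal J$ on $X$ is called $\nabla$-semi-flat if $\mathcal J=F^{-1}(\pi^*\underline{\mathcal J})F$ for some generalized almost complex structure $\underline{\mathcal J}$ on the bundle $V\oplus T_M$ over $M$ with $\underline{\mathcal J}(V\oplus V^\vee)=T_M\oplus T_M^\vee$. Statement. Let $\nabla$ be flat and let $\mathcal J$ be an integrable $\nabla$-semi-flat generalized almost complex structure on $X$. Then the structure $\underline{\mathcal J}$ on $V\oplus T_M$ with $\mathcal J=F^{-1}(\pi^*\underline{\mathcal J})F$ is unique, and the following hold for $$\Delta=\underline{\mathcal J}(V),\qquad \widehat\Delta=\underline{\mathcal J}(V^\vee)\qquad\text{in } T_M\oplus T_M^\vee.$$ 1. $\Delta$ and $\widehat\Delta$ are (integrable) Dirac structures on $M$.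 2. They are transverse: $\Delta\oplus\widehat\Delta=T_M\oplus T_M^\vee$. 3. They inherit flat connections through $\underline{\mathcal J}$: there are flat connections $\nabla^{\Delta}$ on $\Delta$ and $\nabla^{\widehat\Delta}$ on $\widehat\Delta$ such that $\nabla^{\Delta}_v(\underline{\mathcal J}s)=\underline{\mathcal J}(\nabla_v s)$ and $\nabla^{\widehat\Delta}_v(\underline{\mathcal J}\sigma)=\underline{\mathcal J}(\nabla^\vee_v\sigma)$ for all tangent vectors $v$ and all local sections $s$ of $V$ and $\sigma$ of $V^\vee$, where $\nabla^\vee$ is the connection on $V^\vee$ dual to $\nabla$. -/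

import Mathlib

open Bundle Set FiberBundle
open scoped Manifold ContDiff Topology


noncomputable section

namespace GenGeom

/-! ### Smooth sections, and the bundle `W ⊕ W^∨` -/

section Sections

variable {E : Type*} [NormedAddCommGroup E] [NormedSpace ℝ E]
  {H : Type*} [TopologicalSpace H] (I : ModelWithCorners ℝ E H)
  {B : Type*} [TopologicalSpace B] [ChartedSpace H B]
  (F : Type*) [NormedAddCommGroup F] [NormedSpace ℝ F]
  {W : B → Type*} [TopologicalSpace (TotalSpace F W)]
  [∀ x, AddCommGroup (W x)] [∀ x, Module ℝ (W x)]
  [∀ x, TopologicalSpace (W x)] [FiberBundle F W]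

/-- The section `s` of the bundle `W` (with model fibre `F`) is smooth on the set `U`.
Local sections over `U` are encoded as functions on `B` whose values outside `U` are irrelevant. -/
def SmoothOn (U : Set B) (s : Π x, W x) : Prop :=
  ContMDiffOn I (I.prod 𝓘(ℝ, F)) ∞ (fun x ↦ TotalSpace.mk' F x (s x)) U

variable [∀ x, IsTopologicalAddGroup (W x)] [∀ x, ContinuousSMul ℝ (W x)] [VectorBundle ℝ F W]

/-- Smoothness on `U` of a section of the dual bundle `W^∨`. -/
def DualSmoothOn (U : Set B) (ξ : Π x, W x →L[ℝ] ℝ) : Prop :=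
  ContMDiffOn I (I.prod 𝓘(ℝ, F →L[ℝ] ℝ)) ∞
    (fun x ↦ TotalSpace.mk' (F →L[ℝ] ℝ) (E := fun x ↦ W x →L[ℝ] Bundle.Trivial B ℝ x) x (ξ x)) U

variable (W) in
/-- The fibre at `x` of the bundle `W ⊕ W^∨`. -/
abbrev Gen (x : B) : Type _ := W x × (W x →L[ℝ] ℝ)

/-- Smoothness on `U` of a section of `W ⊕ W^∨`. -/
def GenSmoothOn (U : Set B) (a : Π x, Gen W x) : Prop :=
  SmoothOn I F U (fun x ↦ (a x).1) ∧ DualSmoothOn I F U (fun x ↦ (a x).2)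

end Sections

section Dual

variable {E : Type*} [NormedAddCommGroup E] [NormedSpace ℝ E]
  {H : Type*} [TopologicalSpace H] (I : ModelWithCorners ℝ E H)
  {B : Type*} [TopologicalSpace B] [ChartedSpace H B]
  (F : Type*) [NormedAddCommGroup F] [NormedSpace ℝ F]
  {W : B → Type*} [TopologicalSpace (TotalSpace F W)]
  [∀ x, AddCommGroup (W x)] [∀ x, Module ℝ (W x)]
  [∀ x, TopologicalSpace (W x)] [FiberBundle F W]
  [∀ x, IsTopologicalAddGroup (W x)] [∀ x, ContinuousSMul ℝ (W x)] [VectorBundle ℝ F W]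

/-- Differentiability at `x` of a section of the dual bundle `W^∨`. -/
def DualMDiffAt (ξ : Π x, W x →L[ℝ] ℝ) (x : B) : Prop :=
  MDifferentiableAt I (I.prod 𝓘(ℝ, F →L[ℝ] ℝ))
    (fun x ↦ TotalSpace.mk' (F →L[ℝ] ℝ) (E := fun x ↦ W x →L[ℝ] Bundle.Trivial B ℝ x) x (ξ x)) x

variable {I F}

theorem DualMDiffAt.apply {ξ : Π x, W x →L[ℝ] ℝ} {x : B} (h : DualMDiffAt I F ξ x)
    {s : Π x, W x} (hs : MDifferentiableAt I (I.prod 𝓘(ℝ, F)) (fun x ↦ TotalSpace.mk' F x (s x)) x) :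
    MDifferentiableAt I 𝓘(ℝ, ℝ) (fun y ↦ ξ y (s y)) x := by
  have := MDifferentiableAt.clm_bundle_apply (F₁ := F) (F₂ := ℝ)
    (E₂ := Bundle.Trivial B ℝ) h hs
  exact (mdifferentiableAt_section I (fun y ↦ ξ y (s y)) (F := ℝ) (E := Bundle.Trivial B ℝ)).1 this

end Dual

/-- The standard symmetric pairing on `W ⊕ W^∨`. -/
def pairing {W : Type*} [AddCommGroup W] [Module ℝ W] [TopologicalSpace W]
    (a b : W × (W →L[ℝ] ℝ)) : ℝ :=
  -(1 / 2) * (a.2 b.1 + b.2 a.1)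

section GACS

variable {E : Type*} [NormedAddCommGroup E] [NormedSpace ℝ E]
  {H : Type*} [TopologicalSpace H] (I : ModelWithCorners ℝ E H)
  {B : Type*} [TopologicalSpace B] [ChartedSpace H B]
  (F : Type*) [NormedAddCommGroup F] [NormedSpace ℝ F]
  (W : B → Type*) [TopologicalSpace (TotalSpace F W)]
  [∀ x, AddCommGroup (W x)] [∀ x, Module ℝ (W x)]
  [∀ x, TopologicalSpace (W x)] [FiberBundle F W]
  [∀ x, IsTopologicalAddGroup (W x)] [∀ x, ContinuousSMul ℝ (W x)] [VectorBundle ℝ F W]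

/-- A generalized almost complex structure on the vector bundle `W`: a smooth endomorphism `J` of
the bundle `W ⊕ W^∨` which is orthogonal for the standard pairing and satisfies `J² = -1`.
Smoothness of `J` means that it maps smooth local sections to smooth local sections. -/
@[ext]
structure GACS where
  J : Π x : B, Gen W x →L[ℝ] Gen W x
  smooth : ∀ (U : Set B) (a : Π x, Gen W x), IsOpen U → GenSmoothOn I F U a →
    GenSmoothOn I F U (fun x ↦ J x (a x))
  orthogonal : ∀ x (a b : Gen W x), pairing (J x a) (J x b) = pairing a b
  sq : ∀ x (a : Gen W x), J x (J x a) = -a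

end GACS

/-! ### The Courant bracket -/

section Courant

variable {E : Type*} [NormedAddCommGroup E] [NormedSpace ℝ E] [FiniteDimensional ℝ E]
  {H : Type*} [TopologicalSpace H] (I : ModelWithCorners ℝ E H)
  {B : Type*} [TopologicalSpace B] [ChartedSpace H B]

section ExtDer

variable [IsManifold I 2 B]

/-- The right-hand side of the invariant formula
`dη(X, Y) = X(η(Y)) - Y(η(X)) - η([X, Y])`. -/
def extDerAux (η : Π x : B, TangentSpace I x →L[ℝ] ℝ) (x : B) (X Y : Π x : B, TangentSpace I x) :
    ℝ :=
  mvfderiv I (fun y ↦ η y (Y y)) x (X x) - mvfderiv I (fun y ↦ η y (X y)) x (Y x)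
    - η x (VectorField.mlieBracket I X Y x)

variable {I}

theorem extDerAux_swap (η : Π x : B, TangentSpace I x →L[ℝ] ℝ) (x : B)
    (X Y : Π x : B, TangentSpace I x) : extDerAux I η x X Y = - extDerAux I η x Y X := by
  simp only [extDerAux]
  rw [VectorField.mlieBracket_swap_apply, map_neg]
  ring

theorem extDerAux_tensorial {η : Π x : B, TangentSpace I x →L[ℝ] ℝ} {x : B}
    (h : DualMDiffAt I E η x) (Y : Π x : B, TangentSpace I x) (_hY : MDiffAt (T% Y) x) :
    TensorialAt I E (fun X ↦ extDerAux I η x X Y) x := by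
  have : CompleteSpace E := FiniteDimensional.complete ℝ E
  constructor
  · intro f X hf hX
    have e : (fun y ↦ η y ((f • X) y)) = f • fun y ↦ η y (X y) := by
      ext y; simp
    simp only [extDerAux]
    rw [e, mvfderiv_smul hf (h.apply hX), VectorField.mlieBracket_smul_left hf hX]
    simp
    ring
  · intro X X' hX hX'
    have e : (fun y ↦ η y ((X + X') y)) = (fun y ↦ η y (X y)) + fun y ↦ η y (X' y) := by
      ext y; simp
    simp only [extDerAux]
    rw [e, mvfderiv_add (h.apply hX) (h.apply hX'), VectorField.mlieBracket_add_left hX hX']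
    simp
    ring

variable (I)

open Classical in
/-- The exterior derivative `dη` of a one-form, at `x`, as the bilinear form on the tangent space
with `dη(X, Y) = X(η(Y)) - Y(η(X)) - η([X, Y])` for all vector fields `X`, `Y` (see
`extDer_apply`); by convention it is `0` where `η` is not differentiable. -/
def extDer (η : Π x : B, TangentSpace I x →L[ℝ] ℝ) (x : B) :
    TangentSpace I x →L[ℝ] TangentSpace I x →L[ℝ] ℝ :=
  if h : DualMDiffAt I E η x then
    TensorialAt.mkHom₂ (I := I) (F := E) (F' := E) (extDerAux I η x) x
      (fun Y hY ↦ extDerAux_tensorial h Y hY)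
      (fun X hX ↦ by
        have hT := extDerAux_tensorial h X hX
        constructor
        · intro f Y hf hY
          rw [extDerAux_swap, hT.smul hf hY, extDerAux_swap η x X Y, smul_neg]
        · intro Y Y' hY hY'
          rw [extDerAux_swap, hT.add hY hY', extDerAux_swap η x X Y, extDerAux_swap η x X Y',
            neg_add])
  else 0

theorem extDer_apply {η : Π x : B, TangentSpace I x →L[ℝ] ℝ} {x : B} (h : DualMDiffAt I E η x)
    {X Y : Π x : B, TangentSpace I x} (hX : MDiffAt (T% X) x) (hY : MDiffAt (T% Y) x) :
    extDer I η x (X x) (Y x) =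
      mvfderiv I (fun y ↦ η y (Y y)) x (X x) - mvfderiv I (fun y ↦ η y (X y)) x (Y x)
        - η x (VectorField.mlieBracket I X Y x) := by
  rw [extDer, dif_pos h]
  exact TensorialAt.mkHom₂_apply _ _ hX hY

end ExtDer

variable [IsManifold I 2 B]

/-- The Lie derivative `L_X η = ι_X dη + d(ι_X η)` of a one-form. -/
def lieDer (X : Π x : B, TangentSpace I x) (η : Π x : B, TangentSpace I x →L[ℝ] ℝ) (x : B) :
    TangentSpace I x →L[ℝ] ℝ :=
  extDer I η x (X x) + mvfderiv I (fun y ↦ η y (X y)) x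

/-- The Courant bracket
`[X + ξ, Y + η] = [X, Y] + L_X η - L_Y ξ + (1/2) d(ι_Y ξ - ι_X η)` of sections of `T ⊕ T^∨`. -/
def courant (a b : Π x : B, Gen (TangentSpace I : B → Type _) x) (x : B) :
    Gen (TangentSpace I : B → Type _) x :=
  (VectorField.mlieBracket I (fun y ↦ (a y).1) (fun y ↦ (b y).1) x,
    lieDer I (fun y ↦ (a y).1) (fun y ↦ (b y).2) x
      - lieDer I (fun y ↦ (b y).1) (fun y ↦ (a y).2) x
      + (1 / 2 : ℝ) • mvfderiv I (fun y ↦ (a y).2 (b y).1 - (b y).2 (a y).1) x)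

/-! ### Generalized complex structures on manifolds -/

/-- `a + i b`, an element of `(T ⊕ T^∨) ⊗ ℂ`, lies in the `+i`-eigenspace of the complex-linear
extension of `J`. -/
def MemEigen {x : B} (J : Gen (TangentSpace I : B → Type _) x →L[ℝ] Gen (TangentSpace I : B → Type _) x)
    (a b : Gen (TangentSpace I : B → Type _) x) : Prop :=
  J a = -b ∧ J b = a

variable {I} in
/-- A generalized almost complex structure on the manifold `B` is integrable (that is, a generalized
complex structure) if the sheaf of smooth sections of its `+i`-eigenbundle in `(T ⊕ T^∨) ⊗ ℂ` is
closed under the complex-bilinear extension of the Courant bracket. The two complex sections are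
`a + i b` and `c + i d`. -/
def GACS.IsIntegrable (𝒥 : GACS I E (TangentSpace I : B → Type _)) : Prop :=
  ∀ (U : Set B) (a b c d : Π x : B, Gen (TangentSpace I : B → Type _) x), IsOpen U →
    GenSmoothOn I E U a → GenSmoothOn I E U b → GenSmoothOn I E U c → GenSmoothOn I E U d →
    (∀ x ∈ U, MemEigen I (𝒥.J x) (a x) (b x)) → (∀ x ∈ U, MemEigen I (𝒥.J x) (c x) (d x)) →
    ∀ x ∈ U, MemEigen I (𝒥.J x)
      (courant I a c x - courant I b d x) (courant I a d x + courant I b c x)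

/-! ### Dirac structures -/

/-- The family `Δ` of subspaces of the fibres of `T ⊕ T^∨` is a smooth subbundle: near every point
it has a smooth frame (of some finite length `k`). -/
def IsSubbundle (Δ : Π x : B, Submodule ℝ (Gen (TangentSpace I : B → Type _) x)) : Prop :=
  ∀ x₀, ∃ (U : Set B) (k : ℕ) (s : Fin k → Π x : B, Gen (TangentSpace I : B → Type _) x),
    IsOpen U ∧ x₀ ∈ U ∧ (∀ i, GenSmoothOn I E U (s i)) ∧
    ∀ x ∈ U, LinearIndependent ℝ (fun i ↦ s i x) ∧ Submodule.span ℝ (range fun i ↦ s i x) = Δ x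

/-- A subspace of `W ⊕ W^∨` is isotropic if the pairing vanishes on it. -/
def IsIsotropic {W : Type*} [AddCommGroup W] [Module ℝ W] [TopologicalSpace W]
    [IsTopologicalAddGroup W] [ContinuousSMul ℝ W]
    (S : Submodule ℝ (W × (W →L[ℝ] ℝ))) : Prop :=
  ∀ a ∈ S, ∀ b ∈ S, pairing a b = 0

/-- An almost Dirac structure: a maximally isotropic smooth subbundle of `T ⊕ T^∨`. -/
def IsAlmostDirac (Δ : Π x : B, Submodule ℝ (Gen (TangentSpace I : B → Type _) x)) : Prop :=
  IsSubbundle I Δ ∧ ∀ x, Maximal IsIsotropic (Δ x)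

/-- `s` is a smooth section over `U` of the family of subspaces `Δ` of `T ⊕ T^∨`. -/
def IsSectionOn (Δ : Π x : B, Submodule ℝ (Gen (TangentSpace I : B → Type _) x)) (U : Set B)
    (s : Π x : B, Gen (TangentSpace I : B → Type _) x) : Prop :=
  GenSmoothOn I E U s ∧ ∀ x ∈ U, s x ∈ Δ x

/-- A Dirac structure: an almost Dirac structure whose sheaf of smooth sections is closed under the
Courant bracket. -/
def IsDirac (Δ : Π x : B, Submodule ℝ (Gen (TangentSpace I : B → Type _) x)) : Prop :=
  IsAlmostDirac I Δ ∧ ∀ (U : Set B) (a b : Π x : B, Gen (TangentSpace I : B → Type _) x), IsOpen U →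
    IsSectionOn I Δ U a → IsSectionOn I Δ U b → ∀ x ∈ U, courant I a b x ∈ Δ x

/-- A (smooth) connection on a subbundle `Δ` of `T ⊕ T^∨`: a map of sheaves
`∇ : Δ → Δ ⊗ T^∨` with `∇(f s) = s ⊗ df + f ∇ s`. Here `∇ s x v` is the derivative of the section
`s` at `x` in the direction `v`; only its values on smooth local sections of `Δ` are meaningful. -/
structure SubbundleConnection
    (Δ : Π x : B, Submodule ℝ (Gen (TangentSpace I : B → Type _) x)) where
  toFun : (Π x : B, Gen (TangentSpace I : B → Type _) x) →
    Π x : B, TangentSpace I x →L[ℝ] Gen (TangentSpace I : B → Type _) x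
  congr : ∀ (U : Set B) s s', IsOpen U → IsSectionOn I Δ U s → IsSectionOn I Δ U s' →
    (∀ x ∈ U, s x = s' x) → ∀ x ∈ U, toFun s x = toFun s' x
  isSectionOn : ∀ (U : Set B) (s) (X : Π x : B, TangentSpace I x), IsOpen U → IsSectionOn I Δ U s →
    SmoothOn I E U X → IsSectionOn I Δ U (fun x ↦ toFun s x (X x))
  add : ∀ (U : Set B) s s', IsOpen U → IsSectionOn I Δ U s → IsSectionOn I Δ U s' →
    ∀ x ∈ U, toFun (fun y ↦ s y + s' y) x = toFun s x + toFun s' x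
  leibniz : ∀ (U : Set B) (f : B → ℝ) (s), IsOpen U → ContMDiffOn I 𝓘(ℝ, ℝ) ∞ f U →
    IsSectionOn I Δ U s → ∀ x ∈ U, ∀ v : TangentSpace I x,
      toFun (fun y ↦ f y • s y) x v = f x • toFun s x v + mvfderiv I f x v • s x

variable {I} in
/-- A connection on the subbundle `Δ` is flat if its curvature
`∇_X ∇_Y - ∇_Y ∇_X - ∇_{[X, Y]}` vanishes. -/
def SubbundleConnection.IsFlat
    {Δ : Π x : B, Submodule ℝ (Gen (TangentSpace I : B → Type _) x)}
    (D : SubbundleConnection I Δ) : Prop :=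
  ∀ (U : Set B) (X Y : Π x : B, TangentSpace I x) (s), IsOpen U → SmoothOn I E U X →
    SmoothOn I E U Y → IsSectionOn I Δ U s → ∀ x ∈ U,
      D.toFun (fun y ↦ D.toFun s y (Y y)) x (X x) - D.toFun (fun y ↦ D.toFun s y (X y)) x (Y x)
        - D.toFun s x (VectorField.mlieBracket I X Y x) = 0

end Courant

/-! ### Connections on vector bundles, and semi-flat structures on their total spaces -/

section VectorBundle

variable {E : Type*} [NormedAddCommGroup E] [NormedSpace ℝ E] [FiniteDimensional ℝ E]
  {M : Type*} [TopologicalSpace M] [ChartedSpace E M] [IsManifold 𝓘(ℝ, E) ∞ M]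
  {F : Type*} [NormedAddCommGroup F] [NormedSpace ℝ F] [FiniteDimensional ℝ F]
  {V : M → Type*} [TopologicalSpace (TotalSpace F V)]
  [∀ x, AddCommGroup (V x)] [∀ x, Module ℝ (V x)] [∀ x, TopologicalSpace (V x)]
  [∀ x, IsTopologicalAddGroup (V x)] [∀ x, ContinuousSMul ℝ (V x)]
  [FiberBundle F V] [VectorBundle ℝ F V] [ContMDiffVectorBundle ∞ F V 𝓘(ℝ, E)]

/-- The connection `∇` on `V` is flat: its curvature `∇_X ∇_Y - ∇_Y ∇_X - ∇_{[X, Y]}` vanishes. -/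
def IsFlat (cov : CovariantDerivative 𝓘(ℝ, E) F V) : Prop :=
  ∀ (U : Set M) (X Y : Π x : M, TangentSpace 𝓘(ℝ, E) x) (s : Π x, V x), IsOpen U →
    SmoothOn 𝓘(ℝ, E) E U X → SmoothOn 𝓘(ℝ, E) E U Y → SmoothOn 𝓘(ℝ, E) F U s → ∀ x ∈ U,
      cov (fun y ↦ cov s y (Y y)) x (X x) - cov (fun y ↦ cov s y (X y)) x (Y x)
        - cov s x (VectorField.mlieBracket 𝓘(ℝ, E) X Y x) = 0

theorem dualCov_tensorial (cov : CovariantDerivative 𝓘(ℝ, E) F V) {ξ : Π x, V x →L[ℝ] ℝ} {x : M}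
    (h : DualMDiffAt 𝓘(ℝ, E) F ξ x) (v : TangentSpace 𝓘(ℝ, E) x) :
    TensorialAt 𝓘(ℝ, E) F
      (fun s ↦ mvfderiv 𝓘(ℝ, E) (fun y ↦ ξ y (s y)) x v - ξ x (cov s x v)) x := by
  constructor
  · intro f s hf hs
    have e : (fun y ↦ ξ y ((f • s) y)) = f • fun y ↦ ξ y (s y) := by
      ext y; simp
    rw [e, mvfderiv_smul hf (h.apply hs), cov.isCovariantDerivativeOnUniv.leibniz hs hf]
    simp
    ring
  · intro s s' hs hs'
    have e : (fun y ↦ ξ y ((s + s') y)) = (fun y ↦ ξ y (s y)) + fun y ↦ ξ y (s' y) := by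
      ext y; simp
    rw [e, mvfderiv_add (h.apply hs) (h.apply hs'), cov.isCovariantDerivativeOnUniv.add hs hs']
    simp
    ring

open Classical in
/-- The value at `x` of `∇^∨ ξ`, where `∇^∨` is the connection on `V^∨` dual to `∇`:
`(∇^∨_v ξ)(s) = v(ξ(s)) - ξ(∇_v s)` for all sections `s` of `V` (see `dualCov_apply`). By
convention it is `0` where `ξ` is not differentiable. -/
def dualCov (cov : CovariantDerivative 𝓘(ℝ, E) F V) (ξ : Π x, V x →L[ℝ] ℝ) (x : M) :
    TangentSpace 𝓘(ℝ, E) x →L[ℝ] V x →L[ℝ] ℝ :=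
  if h : DualMDiffAt 𝓘(ℝ, E) F ξ x then
    haveI : FiniteDimensional ℝ (TangentSpace 𝓘(ℝ, E) x) := inferInstanceAs (FiniteDimensional ℝ E)
    haveI : T2Space (TangentSpace 𝓘(ℝ, E) x) := inferInstanceAs (T2Space E)
    LinearMap.toContinuousLinearMap
      { toFun := fun v ↦ TensorialAt.mkHom _ x (dualCov_tensorial cov h v)
        map_add' := fun v w ↦ by
          ext e
          simp only [TensorialAt.mkHom_apply_eq_extend, add_apply, map_add]
          ring
        map_smul' := fun c v ↦ by
          ext e
          simp only [TensorialAt.mkHom_apply_eq_extend, smul_apply, map_smul,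
            RingHom.id_apply, smul_eq_mul]
          ring }
  else 0

theorem dualCov_apply (cov : CovariantDerivative 𝓘(ℝ, E) F V) {ξ : Π x, V x →L[ℝ] ℝ} {x : M}
    (h : DualMDiffAt 𝓘(ℝ, E) F ξ x) {s : Π x, V x} (hs : MDiffAt (T% s) x)
    (v : TangentSpace 𝓘(ℝ, E) x) :
    dualCov cov ξ x v (s x) = mvfderiv 𝓘(ℝ, E) (fun y ↦ ξ y (s y)) x v - ξ x (cov s x v) := by
  rw [dualCov, dif_pos h]
  exact TensorialAt.mkHom_apply (dualCov_tensorial cov h v) hs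

/-- The derivative at the point `p` of the parametrization `w ↦ (π(p), e⁻¹ w)` of the fibre through
`p` given by the preferred trivialization `e` at `π(p)`. -/
def fibDeriv (p : TotalSpace F V) : F →L[ℝ] TangentSpace (𝓘(ℝ, E).prod 𝓘(ℝ, F)) p :=
  mfderiv 𝓘(ℝ, F) (𝓘(ℝ, E).prod 𝓘(ℝ, F))
    (fun w : F ↦ TotalSpace.mk' F p.proj ((trivializationAt F V p.proj).symm p.proj w))
    (trivializationAt F V p.proj p).2

/-- The vertical inclusion `j : V_{π(p)} → T_p X`, where `X` is the total space of `V`: the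
derivative of the inclusion of the fibre through `p`. -/
def vert (p : TotalSpace F V) :
    V p.proj →L[ℝ] TangentSpace (𝓘(ℝ, E).prod 𝓘(ℝ, F)) p :=
  (fibDeriv p).comp ((trivializationAt F V p.proj).continuousLinearMapAt ℝ p.proj)

variable (E) in
/-- The differential `dπ : T_p X → T_{π(p)} M` of the projection. -/
def dproj (p : TotalSpace F V) :
    TangentSpace (𝓘(ℝ, E).prod 𝓘(ℝ, F)) p →L[ℝ] TangentSpace 𝓘(ℝ, E) p.proj :=
  mfderiv (𝓘(ℝ, E).prod 𝓘(ℝ, F)) 𝓘(ℝ, E) (fun q : TotalSpace F V ↦ q.proj) p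

/-- The projection `D = (π^*∇)(S) : T_p X → V_{π(p)}` given by the connection, `S` being the
tautological section of `π^* V`. In a local frame `e_i` of `V` with fibre coordinates `ξ_i` one has
`S = ∑ ξ_i e_i` and `D(w) = ∑ dξ_i(w) e_i + ∑ ξ_i(p) ∇_{dπ(w)} e_i`. Here the frame is that of the
preferred trivialization at `π(p)`, and `extend F p.2` is the section `∑ ξ_i(p) e_i`. -/
def connProj (cov : CovariantDerivative 𝓘(ℝ, E) F V) (p : TotalSpace F V) :
    TangentSpace (𝓘(ℝ, E).prod 𝓘(ℝ, F)) p →L[ℝ] V p.proj :=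
  letI e := trivializationAt F V p.proj
  ((e.symmL ℝ p.proj).comp
      (mvfderiv (𝓘(ℝ, E).prod 𝓘(ℝ, F)) (fun q : TotalSpace F V ↦ (e q).2) p))
    + (cov (extend F p.2) p.proj).comp (dproj E p)

/-- The derivative at `π(p)` of the local section `extend F p.2` of `V` through `p`, as a map into the
total space. -/
def secDeriv (p : TotalSpace F V) :
    TangentSpace 𝓘(ℝ, E) p.proj →L[ℝ] TangentSpace (𝓘(ℝ, E).prod 𝓘(ℝ, F)) p :=
  mfderiv 𝓘(ℝ, E) (𝓘(ℝ, E).prod 𝓘(ℝ, F))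
    (fun x ↦ TotalSpace.mk' F x (extend F p.2 x)) p.proj

/-- The horizontal lift `α : T_{π(p)} M → T_p X`, the splitting of `dπ` with `D ∘ α = 0`: for a local
section `s` of `V` through `p`, `α(v) = ds(v) - j(∇_v s)`. -/
def horLift (cov : CovariantDerivative 𝓘(ℝ, E) F V) (p : TotalSpace F V) :
    TangentSpace 𝓘(ℝ, E) p.proj →L[ℝ] TangentSpace (𝓘(ℝ, E).prod 𝓘(ℝ, F)) p :=
  secDeriv p - (vert p).comp (cov (extend F p.2) p.proj)

variable (E V) in
/-- The bundle `V ⊕ T_M` on `M`. -/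
abbrev VT (x : M) : Type _ := V x × TangentSpace 𝓘(ℝ, E) x

/-- The isomorphism `F : T_p X ⊕ T_p^∨ X → V ⊕ T_M ⊕ V^∨ ⊕ T_M^∨`, with the matrix
`(D, dπ) ⊕ (j^∨, α^∨)`. -/
def splitF (cov : CovariantDerivative 𝓘(ℝ, E) F V) (p : TotalSpace F V) :
    Gen (TangentSpace (𝓘(ℝ, E).prod 𝓘(ℝ, F)) : TotalSpace F V → Type _) p →
      Gen (VT E V) p.proj :=
  fun a ↦ ((connProj cov p a.1, dproj E p a.1), a.2.comp ((vert p).coprod (horLift cov p)))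

/-- The inverse `F⁻¹` of `F`, with the matrix `(j, α) ⊕ (D^∨, (dπ)^∨)`. -/
def splitFInv (cov : CovariantDerivative 𝓘(ℝ, E) F V) (p : TotalSpace F V) :
    Gen (VT E V) p.proj →
      Gen (TangentSpace (𝓘(ℝ, E).prod 𝓘(ℝ, F)) : TotalSpace F V → Type _) p :=
  fun b ↦ (vert p b.1.1 + horLift cov p b.1.2, b.2.comp ((connProj cov p).prod (dproj E p)))

/-- `𝒥 = F⁻¹ (π^* J) F`. -/
def IsLiftOf (cov : CovariantDerivative 𝓘(ℝ, E) F V)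
    (𝒥 : GACS (𝓘(ℝ, E).prod 𝓘(ℝ, F)) (E × F)
      (TangentSpace (𝓘(ℝ, E).prod 𝓘(ℝ, F)) : TotalSpace F V → Type _))
    (J : GACS 𝓘(ℝ, E) (F × E) (VT E V)) : Prop :=
  ∀ p a, 𝒥.J p a = splitFInv cov p (J.J p.proj (splitF cov p a))

/-- The inclusion `V ⊕ V^∨ ⊆ (V ⊕ T_M) ⊕ (V ⊕ T_M)^∨`. -/
def inclV (x : M) : Gen V x →ₗ[ℝ] Gen (VT E V) x where
  toFun a := ((a.1, 0), a.2.comp (ContinuousLinearMap.fst ℝ (V x) (TangentSpace 𝓘(ℝ, E) x)))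
  map_add' a b := by ext <;> simp
  map_smul' c a := by ext <;> simp

/-- The inclusion `T_M ⊕ T_M^∨ ⊆ (V ⊕ T_M) ⊕ (V ⊕ T_M)^∨`. -/
def inclT (x : M) : Gen (TangentSpace 𝓘(ℝ, E) : M → Type _) x →ₗ[ℝ] Gen (VT E V) x where
  toFun a := ((0, a.1), a.2.comp (ContinuousLinearMap.snd ℝ (V x) (TangentSpace 𝓘(ℝ, E) x)))
  map_add' a b := by ext <;> simp
  map_smul' c a := by ext <;> simp

/-- The projection of `(V ⊕ T_M) ⊕ (V ⊕ T_M)^∨` onto `T_M ⊕ T_M^∨`. -/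
def projT (x : M) : Gen (VT E V) x →ₗ[ℝ] Gen (TangentSpace 𝓘(ℝ, E) : M → Type _) x where
  toFun b := (b.1.2, b.2.comp (ContinuousLinearMap.inr ℝ (V x) (TangentSpace 𝓘(ℝ, E) x)))
  map_add' a b := by ext <;> simp
  map_smul' c a := by ext <;> simp

/-- The condition `J(V ⊕ V^∨) = T_M ⊕ T_M^∨`. -/
def IsAdapted (J : GACS 𝓘(ℝ, E) (F × E) (VT E V)) : Prop :=
  ∀ x, (LinearMap.range (inclV x)).map (J.J x : Gen (VT E V) x →ₗ[ℝ] Gen (VT E V) x) =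
    LinearMap.range (inclT x)

/-- `𝒥` is an adapted, `∇`-lifted generalized almost complex structure on the total space of `V`;
it is then called `∇`-semi-flat if `∇` is flat. -/
def IsSemiFlat (cov : CovariantDerivative 𝓘(ℝ, E) F V)
    (𝒥 : GACS (𝓘(ℝ, E).prod 𝓘(ℝ, F)) (E × F)
      (TangentSpace (𝓘(ℝ, E).prod 𝓘(ℝ, F)) : TotalSpace F V → Type _)) : Prop :=
  IsFlat cov ∧ ∃ J : GACS 𝓘(ℝ, E) (F × E) (VT E V), IsLiftOf cov 𝒥 J ∧ IsAdapted J

/-- The restriction of `J` to `V ⊕ V^∨`, with values in `T_M ⊕ T_M^∨` (where it takes its values if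
`J` is adapted). -/
def baseMap (J : GACS 𝓘(ℝ, E) (F × E) (VT E V)) (x : M) :
    Gen V x →ₗ[ℝ] Gen (TangentSpace 𝓘(ℝ, E) : M → Type _) x :=
  (projT x).comp ((J.J x : Gen (VT E V) x →ₗ[ℝ] Gen (VT E V) x).comp (inclV x))

/-- `Δ = J(V)`, as a family of subspaces of the fibres of `T_M ⊕ T_M^∨`. -/
def diracV (J : GACS 𝓘(ℝ, E) (F × E) (VT E V)) (x : M) :
    Submodule ℝ (Gen (TangentSpace 𝓘(ℝ, E) : M → Type _) x) :=
  LinearMap.range ((baseMap J x).comp (LinearMap.inl ℝ (V x) (V x →L[ℝ] ℝ)))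

/-- `Δ̂ = J(V^∨)`, as a family of subspaces of the fibres of `T_M ⊕ T_M^∨`. -/
def diracVDual (J : GACS 𝓘(ℝ, E) (F × E) (VT E V)) (x : M) :
    Submodule ℝ (Gen (TangentSpace 𝓘(ℝ, E) : M → Type _) x) :=
  LinearMap.range ((baseMap J x).comp (LinearMap.inr ℝ (V x) (V x →L[ℝ] ℝ)))

end VectorBundle

end GenGeom

end

/-!
The identification `F` carries the bracket of the total space at a point of the zero section to
data on `M`. A section `a` of `V ⊕ V^∨` has a lift `liftV a`, constant along the fibres, and a
section `A` of `T_M ⊕ T_M^∨` has a horizontal lift `liftT A`. On the zero section the curvature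
terms drop out, and for `∇`-parallel isotropic data `liftV a` and `liftV c` commute, while
`[liftT A, liftT C]` is the lift of `[A, C]` and `[liftT A, liftV a]` is the lift of `∇_A a`. The
sections `liftT (J a) + i liftV a` lie in the `+i`-eigenbundle of the lifted structure, and the
imaginary part of integrability reads `[J a, J c] = J (∇_{J a} c - ∇_{J c} a)`. As `V` and `V^∨`
are parallel and maximally isotropic in `V ⊕ V^∨`, their images under the isometry `J` are Dirac
structures, and complementary because `V` and `V^∨` are. The connections are `∇` and `∇^∨`
transported by `J`.
-/

noncomputable section

namespace GenGeom

/-! ### Pointwise smoothness of sections -/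

section SmoothAt

variable {E : Type*} [NormedAddCommGroup E] [NormedSpace ℝ E]
  {H : Type*} [TopologicalSpace H] (I : ModelWithCorners ℝ E H)
  {B : Type*} [TopologicalSpace B] [ChartedSpace H B]
  (F : Type*) [NormedAddCommGroup F] [NormedSpace ℝ F]
  {W : B → Type*} [TopologicalSpace (TotalSpace F W)] [∀ x, TopologicalSpace (W x)]
  [FiberBundle F W]

/-- Smoothness at the point `x₀` of a section of `W` with model fibre `F`. -/
def SmoothAt (s : Π x, W x) (x₀ : B) : Prop :=
  ContMDiffAt I (I.prod 𝓘(ℝ, F)) ∞ (fun x ↦ TotalSpace.mk' F x (s x)) x₀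

/-- Smoothness of a section of `W` in a neighbourhood of the point `x₀`. -/
def SmoothNear (s : Π x, W x) (x₀ : B) : Prop := ∀ᶠ x in 𝓝 x₀, SmoothAt I F s x

variable {I F} {s t : Π x, W x} {U : Set B} {x : B}

theorem SmoothNear.smoothAt (h : SmoothNear I F s x) : SmoothAt I F s x :=
  Filter.Eventually.self_of_nhds h

theorem smoothOn_iff (hU : IsOpen U) : SmoothOn I F U s ↔ ∀ x ∈ U, SmoothAt I F s x :=
  ⟨fun h _ hx ↦ h.contMDiffAt (hU.mem_nhds hx), fun h _ hx ↦ (h _ hx).contMDiffWithinAt⟩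

theorem SmoothOn.smoothNear (h : SmoothOn I F U s) (hU : IsOpen U) (hx : x ∈ U) :
    SmoothNear I F s x :=
  Filter.mem_of_superset (hU.mem_nhds hx) ((smoothOn_iff hU).1 h)

theorem SmoothNear.exists_smoothOn (h : SmoothNear I F s x) :
    ∃ U, IsOpen U ∧ x ∈ U ∧ SmoothOn I F U s := by
  obtain ⟨U, hU, hUo, hx⟩ := mem_nhds_iff.1 h
  exact ⟨U, hUo, hx, (smoothOn_iff hUo).2 hU⟩

theorem SmoothAt.congr (h : SmoothAt I F s x) (hst : ∀ᶠ y in 𝓝 x, t y = s y) :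
    SmoothAt I F t x :=
  ContMDiffAt.congr_of_eventuallyEq h (hst.mono fun y hy ↦ by simp only [hy])

theorem SmoothAt.mdifferentiableAt (h : SmoothAt I F s x) : MDiffAt (T% s) x :=
  ContMDiffAt.mdifferentiableAt h (by simp)

end SmoothAt

section DualSmoothAt

variable {E : Type*} [NormedAddCommGroup E] [NormedSpace ℝ E]
  {H : Type*} [TopologicalSpace H] (I : ModelWithCorners ℝ E H)
  {B : Type*} [TopologicalSpace B] [ChartedSpace H B]
  (F : Type*) [NormedAddCommGroup F] [NormedSpace ℝ F]
  {W : B → Type*} [TopologicalSpace (TotalSpace F W)]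
  [∀ x, AddCommGroup (W x)] [∀ x, Module ℝ (W x)] [∀ x, TopologicalSpace (W x)]
  [FiberBundle F W] [VectorBundle ℝ F W]

/-- Smoothness at the point `x₀` of a section of the dual bundle `W^∨`. -/
def DualSmoothAt (ξ : Π x, W x →L[ℝ] ℝ) (x₀ : B) : Prop :=
  ContMDiffAt I (I.prod 𝓘(ℝ, F →L[ℝ] ℝ)) ∞
    (fun x ↦ TotalSpace.mk' (F →L[ℝ] ℝ) (E := fun x ↦ W x →L[ℝ] Bundle.Trivial B ℝ x) x (ξ x)) x₀

/-- Smoothness of a section of `W^∨` in a neighbourhood of the point `x₀`. -/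
def DualSmoothNear (ξ : Π x, W x →L[ℝ] ℝ) (x₀ : B) : Prop := ∀ᶠ x in 𝓝 x₀, DualSmoothAt I F ξ x

/-- Smoothness at the point `x₀` of a section of `W ⊕ W^∨`. -/
def GenSmoothAt (a : Π x, Gen W x) (x₀ : B) : Prop :=
  SmoothAt I F (fun x ↦ (a x).1) x₀ ∧ DualSmoothAt I F (fun x ↦ (a x).2) x₀

/-- Smoothness of a section of `W ⊕ W^∨` in a neighbourhood of the point `x₀`. -/
def GenSmoothNear (a : Π x, Gen W x) (x₀ : B) : Prop := ∀ᶠ x in 𝓝 x₀, GenSmoothAt I F a x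

variable {I F} {s : Π x, W x} {ξ : Π x, W x →L[ℝ] ℝ} {a : Π x, Gen W x} {U : Set B} {x : B}

theorem DualSmoothNear.dualSmoothAt (h : DualSmoothNear I F ξ x) : DualSmoothAt I F ξ x :=
  Filter.Eventually.self_of_nhds h

theorem dualSmoothOn_iff (hU : IsOpen U) :
    DualSmoothOn I F U ξ ↔ ∀ x ∈ U, DualSmoothAt I F ξ x :=
  ⟨fun h _ hx ↦ ContMDiffOn.contMDiffAt h (hU.mem_nhds hx),
    fun h _ hx ↦ ContMDiffAt.contMDiffWithinAt (h _ hx)⟩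

theorem DualSmoothAt.dualMDiffAt (h : DualSmoothAt I F ξ x) : DualMDiffAt I F ξ x :=
  ContMDiffAt.mdifferentiableAt h (by simp)

theorem DualSmoothAt.apply (h : DualSmoothAt I F ξ x) (hs : SmoothAt I F s x) :
    ContMDiffAt I 𝓘(ℝ, ℝ) ∞ (fun y ↦ ξ y (s y)) x :=
  (contMDiffAt_section (IB := I) (F := ℝ) (E := Bundle.Trivial B ℝ) x).1 <|
    ContMDiffAt.clm_bundle_apply (F₁ := F) (F₂ := ℝ) (E₂ := Bundle.Trivial B ℝ) h hs

theorem genSmoothOn_iff (hU : IsOpen U) : GenSmoothOn I F U a ↔ ∀ x ∈ U, GenSmoothAt I F a x := by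
  rw [GenSmoothOn, smoothOn_iff hU, dualSmoothOn_iff hU, ← forall₂_and]
  rfl

theorem GenSmoothOn.genSmoothNear (h : GenSmoothOn I F U a) (hU : IsOpen U) (hx : x ∈ U) :
    GenSmoothNear I F a x :=
  Filter.mem_of_superset (hU.mem_nhds hx) ((genSmoothOn_iff hU).1 h)

theorem GenSmoothNear.genSmoothAt (h : GenSmoothNear I F a x) : GenSmoothAt I F a x :=
  Filter.Eventually.self_of_nhds h

theorem GenSmoothNear.fst (h : GenSmoothNear I F a x) : SmoothNear I F (fun y ↦ (a y).1) x :=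
  Filter.Eventually.mono h fun _ hy ↦ hy.1

theorem GenSmoothNear.snd (h : GenSmoothNear I F a x) : DualSmoothNear I F (fun y ↦ (a y).2) x :=
  Filter.Eventually.mono h fun _ hy ↦ hy.2

end DualSmoothAt

section LocalFrames

variable {E : Type*} [NormedAddCommGroup E] [NormedSpace ℝ E]
  {H : Type*} [TopologicalSpace H] {I : ModelWithCorners ℝ E H}
  {B : Type*} [TopologicalSpace B] [ChartedSpace H B]
  {F : Type*} [NormedAddCommGroup F] [NormedSpace ℝ F]

theorem contMDiffAt_clm_apply_iff [FiniteDimensional ℝ F] {G : Type*} [NormedAddCommGroup G]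
    [NormedSpace ℝ G] {f : B → F →L[ℝ] G} {x : B} :
    ContMDiffAt I 𝓘(ℝ, F →L[ℝ] G) ∞ f x ↔
      ∀ c, ContMDiffAt I 𝓘(ℝ, G) ∞ (fun y ↦ f y c) x := by
  refine ⟨fun h c ↦ h.clm_apply contMDiffAt_const, fun h ↦ ?_⟩
  let b := Module.finBasis ℝ F
  have hf : f = fun y ↦ ∑ i, (ContinuousLinearMap.smulRightL ℝ F G
      (LinearMap.toContinuousLinearMap (b.coord i))) (f y (b i)) := by
    ext y c
    conv_lhs => rw [← b.sum_repr c, map_sum]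
    simp
  rw [hf]
  exact ContMDiffAt.sum fun i _ ↦ contMDiffAt_const.clm_apply (h (b i))

variable {W : B → Type*} [TopologicalSpace (TotalSpace F W)]
  [∀ x, AddCommGroup (W x)] [∀ x, Module ℝ (W x)] [∀ x, TopologicalSpace (W x)]
  [FiberBundle F W] [VectorBundle ℝ F W] [ContMDiffVectorBundle ∞ F W I]

theorem smoothAt_symm (e : Trivialization F (TotalSpace.proj : TotalSpace F W → B))
    [MemTrivializationAtlas e] {x : B} (hx : x ∈ e.baseSet) (c : F) :
    SmoothAt I F (fun y ↦ e.symm y c) x := by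
  rw [SmoothAt, e.contMDiffAt_section_iff hx]
  refine (contMDiffAt_const (c := c)).congr_of_eventuallyEq ?_
  filter_upwards [e.open_baseSet.mem_nhds hx] with y hy
  simp [e.apply_mk_symm hy]

theorem smoothNear_symm (e : Trivialization F (TotalSpace.proj : TotalSpace F W → B))
    [MemTrivializationAtlas e] {x : B} (hx : x ∈ e.baseSet) (c : F) :
    SmoothNear I F (fun y ↦ e.symm y c) x :=
  Filter.mem_of_superset (e.open_baseSet.mem_nhds hx) fun _ hy ↦ smoothAt_symm e hy c

theorem smoothNear_extend {x : B} (v : W x) : SmoothNear I F (extend F v) x :=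
  smoothNear_symm _ (mem_baseSet_trivializationAt F W x) _

variable [FiniteDimensional ℝ F] {ξ : Π x, W x →L[ℝ] ℝ} {x : B}

omit [ContMDiffVectorBundle ∞ F W I] in
theorem dualSmoothAt_iff_symm :
    DualSmoothAt I F ξ x ↔ ∀ c : F, ContMDiffAt I 𝓘(ℝ, ℝ) ∞
      (fun y ↦ ξ y ((trivializationAt F W x).symm y c)) x := by
  set e := trivializationAt F W x
  have hx : x ∈ e.baseSet := mem_baseSet_trivializationAt F W x
  rw [DualSmoothAt, contMDiffAt_hom_bundle, contMDiffAt_clm_apply_iff]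
  refine (and_iff_right contMDiffAt_id).trans <| forall_congr' fun c ↦
    Filter.EventuallyEq.contMDiffAt_iff ?_
  filter_upwards [e.open_baseSet.mem_nhds hx] with y hy
  rw [ContinuousLinearMap.inCoordinates_eq hy (by simp)]
  simp [e]

theorem dualSmoothAt_of_forall
    (h : ∀ s : Π x, W x, SmoothNear I F s x → ContMDiffAt I 𝓘(ℝ, ℝ) ∞ (fun y ↦ ξ y (s y)) x) :
    DualSmoothAt I F ξ x :=
  dualSmoothAt_iff_symm.2 fun c ↦ h _ (smoothNear_symm _ (mem_baseSet_trivializationAt F W x) c)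

end LocalFrames

/-! ### Vector fields as derivations -/

section VectorFields

variable {E : Type*} [NormedAddCommGroup E] [NormedSpace ℝ E]
  {H : Type*} [TopologicalSpace H] {I : ModelWithCorners ℝ E H}
  {B : Type*} [TopologicalSpace B] [ChartedSpace H B]
  {G : Type*} [NormedAddCommGroup G] [NormedSpace ℝ G]

theorem mvfderiv_congr {f g : B → G} {x : B} (h : f =ᶠ[𝓝 x] g) (v : TangentSpace I x) :
    mvfderiv I f x v = mvfderiv I g x v :=
  congrArg (fun L : E →L[ℝ] G ↦ L v) h.mfderiv_eq

variable [IsManifold I ∞ B]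

theorem smoothAt_vectorField_iff {A : Π x : B, TangentSpace I x} {x : B} :
    SmoothAt I E A x ↔ ContMDiffAt I 𝓘(ℝ, E) ∞
      (fun y ↦ mvfderiv I (extChartAt I x) y (A y)) x := by
  rw [SmoothAt, contMDiffAt_section]
  refine Filter.EventuallyEq.contMDiffAt_iff ?_
  filter_upwards [(chartAt H x).open_source.mem_nhds (mem_chart_source H x)] with y hy
  refine Eq.trans ?_ (congrArg (fun f ↦ f (A y))
    (TangentBundle.continuousLinearMapAt_trivializationAt (I := I) hy))
  rw [Trivialization.continuousLinearMapAt_apply, Trivialization.coe_linearMapAt_of_mem]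
  exact hy

theorem contMDiffAt_mvfderiv_apply {f : B → G} {x : B} (hf : ContMDiffAt I 𝓘(ℝ, G) ∞ f x)
    {A : Π x : B, TangentSpace I x} (hA : SmoothAt I E A x) :
    ContMDiffAt I 𝓘(ℝ, G) ∞ (fun y ↦ mvfderiv I f y (A y)) x := by
  have hdf : ContMDiffAt I 𝓘(ℝ, G).tangent ∞
      (fun y ↦ (⟨f y, mfderiv I 𝓘(ℝ, G) f y (A y)⟩ : TangentBundle 𝓘(ℝ, G) G)) x :=
    ContMDiffAt.clm_apply_of_inCoordinates (hf.mfderiv_const (by simp)) hA hf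
  exact ((contMDiff_snd_tangentBundle_modelSpace G 𝓘(ℝ, G)).contMDiffAt).comp x hdf

open VectorField

omit [IsManifold I ∞ B] in
theorem mvfderiv_comp_mpullback {E' : Type*} [NormedAddCommGroup E'] [NormedSpace ℝ E']
    {H' : Type*} [TopologicalSpace H'] {I' : ModelWithCorners ℝ E' H'}
    {B' : Type*} [TopologicalSpace B'] [ChartedSpace H' B'] {ψ : B' → B} {y : B'}
    (hψ : MDifferentiableAt I' I ψ y) (hinv : (mfderiv I' I ψ y).IsInvertible)
    {f : B → G} (hf : MDifferentiableAt I 𝓘(ℝ, G) f (ψ y)) (V : Π x : B, TangentSpace I x) :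
    mvfderiv I' (f ∘ ψ) y (mpullback I' I ψ V y) = mvfderiv I f (ψ y) (V (ψ y)) :=
  (mfderiv_comp_apply (I' := I) y hf hψ _).trans <|
    congrArg (mvfderiv I f (ψ y)) (DFunLike.congr_fun hinv.self_comp_inverse _)

theorem mvfderiv_mlieBracket_of_parametrization [CompleteSpace E] {ψ : E → B} {y : E}
    (hψ : ∀ᶠ z in 𝓝 y, ContMDiffAt 𝓘(ℝ, E) I ∞ ψ z ∧ (mfderiv 𝓘(ℝ, E) I ψ z).IsInvertible)
    {f : B → G} (hf : ContMDiffAt I 𝓘(ℝ, G) ∞ f (ψ y)) {V W : Π x : B, TangentSpace I x}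
    (hV : SmoothAt I E V (ψ y)) (hW : SmoothAt I E W (ψ y)) :
    mvfderiv I f (ψ y) (mlieBracket I V W (ψ y)) =
      mvfderiv I (fun z ↦ mvfderiv I f z (W z)) (ψ y) (V (ψ y))
        - mvfderiv I (fun z ↦ mvfderiv I f z (V z)) (ψ y) (W (ψ y)) := by
  have h_two : minSmoothness ℝ 2 ≤ ∞ := by
    rw [minSmoothness_of_isRCLikeNormedField]
    norm_cast
  have : IsManifold I (minSmoothness ℝ 2) B := .of_le h_two
  obtain ⟨hψy, hinv⟩ := hψ.self_of_nhds
  have hf_near : ∀ᶠ z in 𝓝 y, MDifferentiableAt I 𝓘(ℝ, G) f (ψ z) :=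
    (hψy.continuousAt.eventually ((contMDiffAt_iff_contMDiffAt_nhds (by simp)).1
      (hf.of_le (mod_cast le_top : (1 : ℕ∞ω) ≤ ∞)))).mono fun z hz ↦
        hz.mdifferentiableAt (by simp)
  have hcomp {g : B → G} (hg : MDifferentiableAt I 𝓘(ℝ, G) g (ψ y))
      (A : Π x : B, TangentSpace I x) :
      mvfderiv I g (ψ y) (A (ψ y)) = fderiv ℝ (g ∘ ψ) y (mpullback 𝓘(ℝ, E) I ψ A y) :=
    (mvfderiv_comp_mpullback (hψy.mdifferentiableAt (by simp)) hinv hg A).symm.trans <|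
      congrArg (fun L : E →L[ℝ] G ↦ L (mpullback 𝓘(ℝ, E) I ψ A y)) mfderiv_eq_fderiv
  have hderiv (A : Π x : B, TangentSpace I x) {C : Π x : B, TangentSpace I x}
      (hC : SmoothAt I E C (ψ y)) :
      mvfderiv I (fun z ↦ mvfderiv I f z (C z)) (ψ y) (A (ψ y)) =
        fderiv ℝ (fun z ↦ fderiv ℝ (f ∘ ψ) z (mpullback 𝓘(ℝ, E) I ψ C z)) y
          (mpullback 𝓘(ℝ, E) I ψ A y) := by
    rw [hcomp ((contMDiffAt_mvfderiv_apply hf hC).mdifferentiableAt (by simp))]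
    refine congrArg (fun L : E →L[ℝ] G ↦ L _) (Filter.EventuallyEq.fderiv_eq ?_)
    filter_upwards [hψ, hf_near] with z hz hfz
    refine (mvfderiv_comp_mpullback (hz.1.mdifferentiableAt (by simp)) hz.2 hfz C).symm.trans ?_
    exact congrArg (fun L : E →L[ℝ] G ↦ L _) mfderiv_eq_fderiv
  have hdiff {A : Π x : B, TangentSpace I x} (hA : SmoothAt I E A (ψ y)) :
      DifferentiableAt ℝ (fun z ↦ (mpullback 𝓘(ℝ, E) I ψ A z : E)) y :=
    (contMDiffAt_vectorSpace_iff_contDiffAt.1 (ContMDiffAt.mpullback_vectorField_preimage (m := 1)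
      (hA.of_le (mod_cast le_top)) hψy hinv (by norm_cast))).differentiableAt one_ne_zero
  rw [hderiv V hW, hderiv W hV, hcomp (hf.mdifferentiableAt (by simp)),
    mpullback_mlieBracket hV.mdifferentiableAt hW.mdifferentiableAt hψy h_two,
    ← mlieBracketWithin_univ (I := 𝓘(ℝ, E)), mlieBracketWithin_eq_lieBracketWithin]
  exact (congrArg _ (congrFun lieBracketWithin_univ y)).trans <|
    fderiv_apply_lieBracket (hf.comp y hψy).contDiffAt h_two (hdiff hW) (hdiff hV)

theorem mvfderiv_mlieBracket [CompleteSpace E] [I.Boundaryless] {f : B → G} {x : B}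
    (hf : ContMDiffAt I 𝓘(ℝ, G) ∞ f x) {V W : Π x : B, TangentSpace I x}
    (hV : SmoothAt I E V x) (hW : SmoothAt I E W x) :
    mvfderiv I f x (mlieBracket I V W x) =
      mvfderiv I (fun y ↦ mvfderiv I f y (W y)) x (V x)
        - mvfderiv I (fun y ↦ mvfderiv I f y (V y)) x (W x) := by
  have hψ : ∀ᶠ y in 𝓝 (extChartAt I x x), ContMDiffAt 𝓘(ℝ, E) I ∞ (extChartAt I x).symm y ∧
      (mfderiv 𝓘(ℝ, E) I (extChartAt I x).symm y).IsInvertible := by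
    filter_upwards [(isOpen_extChartAt_target x).mem_nhds (mem_extChartAt_target x)] with y hy
    have hinv := isInvertible_mfderivWithin_extChartAt_symm hy
    rw [I.range_eq_univ, mfderivWithin_univ] at hinv
    exact ⟨(contMDiffOn_extChartAt_symm x).contMDiffAt
      ((isOpen_extChartAt_target x).mem_nhds hy), hinv⟩
  have key := mvfderiv_mlieBracket_of_parametrization (f := f) (V := V) (W := W) hψ
  rw [extChartAt_to_inv] at key
  exact key hf hV hW

end VectorFields

section Deriv

variable {E : Type*} [NormedAddCommGroup E] [NormedSpace ℝ E]
  {H : Type*} [TopologicalSpace H] {I : ModelWithCorners ℝ E H}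
  {B : Type*} [TopologicalSpace B] [ChartedSpace H B]
  {G : Type*} [NormedAddCommGroup G] [NormedSpace ℝ G]

theorem mvfderiv_const_apply (c : G) {x : B} (v : TangentSpace I x) :
    mvfderiv I (fun _ : B ↦ c) x v = 0 := by
  rw [mvfderiv_const]
  rfl

theorem mvfderiv_apply_mfderiv {E' : Type*} [NormedAddCommGroup E'] [NormedSpace ℝ E']
    {H' : Type*} [TopologicalSpace H'] {I' : ModelWithCorners ℝ E' H'}
    {B' : Type*} [TopologicalSpace B'] [ChartedSpace H' B'] {f : B → B'} {g : B' → G}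
    {x : B} {y : B'} (hy : f x = y) (hg : MDifferentiableAt I' 𝓘(ℝ, G) g y)
    (hf : MDifferentiableAt I I' f x) (v : TangentSpace I x) :
    mvfderiv I' g y (mfderiv I I' f x v : TangentSpace I' y) = mvfderiv I (g ∘ f) x v := by
  subst hy
  exact (mfderiv_comp_apply x hg hf v).symm

theorem mvfderiv_clm_comp {G' : Type*} [NormedAddCommGroup G'] [NormedSpace ℝ G'] (L : G →L[ℝ] G')
    {f : B → G} {x : B} (hf : MDifferentiableAt I 𝓘(ℝ, G) f x) (v : TangentSpace I x) :
    mvfderiv I (fun y ↦ L (f y)) x v = L (mvfderiv I f x v) := by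
  have := mfderiv_comp_apply x (L.mdifferentiableAt (x := f x)) hf v
  rw [L.mfderiv_eq] at this
  exact this

theorem contMDiffAt_of_forall_dual [FiniteDimensional ℝ G] {f : B → G} {x : B}
    (h : ∀ l : G →L[ℝ] ℝ, ContMDiffAt I 𝓘(ℝ, ℝ) ∞ (fun y ↦ l (f y)) x) :
    ContMDiffAt I 𝓘(ℝ, G) ∞ f x := by
  let b := Module.finBasis ℝ G
  have hf : f = fun y ↦ ∑ i, LinearMap.toContinuousLinearMap (b.coord i) (f y) • b i := by
    ext y
    exact (b.sum_repr (f y)).symm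
  rw [hf]
  exact ContMDiffAt.sum fun i _ ↦ (h _).smul contMDiffAt_const

theorem eq_of_forall_mvfderiv_eq [IsManifold I ∞ B] {x : B} {v w : TangentSpace I x}
    (h : ∀ f : B → ℝ, (∀ᶠ y in 𝓝 x, ContMDiffAt I 𝓘(ℝ, ℝ) ∞ f y) →
      mvfderiv I f x v = mvfderiv I f x w) : v = w := by
  obtain ⟨L, hL⟩ := isInvertible_mfderiv_extChartAt (I := I) (mem_extChartAt_source (I := I) x)
  have hchart : ∀ᶠ y in 𝓝 x, ContMDiffAt I 𝓘(ℝ, E) ∞ (extChartAt I x) y := by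
    filter_upwards [(chartAt H x).open_source.mem_nhds (mem_chart_source H x)] with y hy
    exact contMDiffAt_extChartAt' hy
  refine L.injective ?_
  rw [← ContinuousLinearEquiv.coe_coe, hL]
  refine (SeparatingDual.eq_iff_forall_dual_eq (R := ℝ) (V := E)).2 fun l ↦ ?_
  have hd := hchart.self_of_nhds.mdifferentiableAt (by simp)
  refine (mvfderiv_clm_comp l hd v).symm.trans (Eq.trans ?_ (mvfderiv_clm_comp l hd w))
  exact h _ (hchart.mono fun y hy ↦ l.contMDiff.contMDiffAt.comp y hy)

end Deriv

/-! ### Evaluation of the Courant bracket on vector fields -/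

section Courant

variable {E : Type*} [NormedAddCommGroup E] [NormedSpace ℝ E] [FiniteDimensional ℝ E]
  {H : Type*} [TopologicalSpace H] {I : ModelWithCorners ℝ E H}
  {B : Type*} [TopologicalSpace B] [ChartedSpace H B]

theorem courant_fst [IsManifold I 2 B]
    (a b : Π x : B, Gen (TangentSpace I : B → Type _) x) (x : B) :
    (courant I a b x).1 = VectorField.mlieBracket I (fun y ↦ (a y).1) (fun y ↦ (b y).1) x :=
  rfl

theorem courant_swap [IsManifold I 2 B]
    (a b : Π x : B, Gen (TangentSpace I : B → Type _) x) (x : B) :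
    courant I b a x = -courant I a b x := by
  refine Prod.ext (VectorField.mlieBracket_swap_apply ..) ?_
  have h : (fun y ↦ (b y).2 (a y).1 - (a y).2 (b y).1) =
      -fun y ↦ (a y).2 (b y).1 - (b y).2 (a y).1 := by
    ext y
    simp
  simp only [courant, Prod.snd_neg, h, mvfderiv_neg, smul_neg]
  abel

variable [IsManifold I ∞ B]

theorem lieDer_apply {η : Π x : B, TangentSpace I x →L[ℝ] ℝ} {x : B} (h : DualSmoothAt I E η x)
    {X Z : Π x : B, TangentSpace I x} (hX : SmoothAt I E X x) (hZ : SmoothAt I E Z x) :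
    lieDer I X η x (Z x) = mvfderiv I (fun y ↦ η y (Z y)) x (X x)
      - η x (VectorField.mlieBracket I X Z x) := by
  rw [lieDer, add_apply, extDer_apply I h.dualMDiffAt hX.mdifferentiableAt hZ.mdifferentiableAt]
  ring

theorem courant_snd_apply {a b : Π x : B, Gen (TangentSpace I : B → Type _) x} {x : B}
    (ha : GenSmoothAt I E a x) (hb : GenSmoothAt I E b x) {Z : Π x : B, TangentSpace I x}
    (hZ : SmoothAt I E Z x) :
    (courant I a b x).2 (Z x) =
      (mvfderiv I (fun y ↦ (b y).2 (Z y)) x (a x).1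
        - (b x).2 (VectorField.mlieBracket I (fun y ↦ (a y).1) Z x))
      - (mvfderiv I (fun y ↦ (a y).2 (Z y)) x (b x).1
        - (a x).2 (VectorField.mlieBracket I (fun y ↦ (b y).1) Z x))
      + 1 / 2 * mvfderiv I (fun y ↦ (a y).2 (b y).1 - (b y).2 (a y).1) x (Z x) := by
  simp only [courant, add_apply, sub_apply, smul_apply, smul_eq_mul]
  rw [lieDer_apply hb.2 ha.1 hZ, lieDer_apply ha.2 hb.1 hZ]

end Courant

/-! ### The dual connection -/

section Congr

variable {E : Type*} [NormedAddCommGroup E] [NormedSpace ℝ E]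
  {H : Type*} [TopologicalSpace H] {I : ModelWithCorners ℝ E H}
  {B : Type*} [TopologicalSpace B] [ChartedSpace H B]
  {F : Type*} [NormedAddCommGroup F] [NormedSpace ℝ F]
  {W : B → Type*} [TopologicalSpace (TotalSpace F W)]
  [∀ x, AddCommGroup (W x)] [∀ x, Module ℝ (W x)] [∀ x, TopologicalSpace (W x)]
  [∀ x, IsTopologicalAddGroup (W x)] [∀ x, ContinuousSMul ℝ (W x)] [FiberBundle F W]

theorem cov_congr {cov : CovariantDerivative I F W} {s t : Π x, W x} {x : B}
    (hs : SmoothAt I F s x) (ht : SmoothAt I F t x) (hst : ∀ᶠ y in 𝓝 x, s y = t y) :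
    cov s x = cov t x :=
  cov.isCovariantDerivativeOnUniv.congr_of_eventuallyEq hs.mdifferentiableAt ht.mdifferentiableAt
    Filter.univ_mem hst

end Congr

section Connection

variable {E : Type*} [NormedAddCommGroup E] [NormedSpace ℝ E]
  {M : Type*} [TopologicalSpace M] [ChartedSpace E M] [IsManifold 𝓘(ℝ, E) ∞ M]
  {F : Type*} [NormedAddCommGroup F] [NormedSpace ℝ F]
  {V : M → Type*} [TopologicalSpace (TotalSpace F V)]
  [∀ x, AddCommGroup (V x)] [∀ x, Module ℝ (V x)] [∀ x, TopologicalSpace (V x)]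
  [∀ x, IsTopologicalAddGroup (V x)] [∀ x, ContinuousSMul ℝ (V x)]
  [FiberBundle F V] [VectorBundle ℝ F V]
  {cov : CovariantDerivative 𝓘(ℝ, E) F V} {s t : Π x, V x} {ξ ζ : Π x, V x →L[ℝ] ℝ} {x : M}
  {X Y : Π x : M, TangentSpace 𝓘(ℝ, E) x}

theorem cov_smoothAt [FiniteDimensional ℝ E] [T2Space M] (hcov : cov.ContMDiffCovariantDerivative ∞)
    (hs : SmoothNear 𝓘(ℝ, E) F s x) (hX : SmoothAt 𝓘(ℝ, E) E X x) :
    SmoothAt 𝓘(ℝ, E) F (fun y ↦ cov s y (X y)) x := by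
  obtain ⟨U, hU, hx, hsU⟩ := hs.exists_smoothOn
  -- Smoothness of `cov` is only known on global sections, so `s` is cut off.
  obtain ⟨ψ, -, hψ⟩ := (SmoothBumpFunction.nhds_basis_tsupport (I := 𝓘(ℝ, E)) x).mem_iff.1
    (hU.mem_nhds hx)
  have hψs : ContMDiff 𝓘(ℝ, E) (𝓘(ℝ, E).prod 𝓘(ℝ, F)) ∞
      (fun y ↦ TotalSpace.mk' F y (((ψ : M → ℝ) • s) y)) :=
    ContMDiffOn.smul_section_of_tsupport ψ.contMDiff.contMDiffOn hU hψ hsU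
  have hcovψs := hcov.contMDiff.contMDiff (σ := (ψ : M → ℝ) • s) hψs.contMDiffOn
  have hcovX : SmoothAt 𝓘(ℝ, E) F (fun y ↦ cov ((ψ : M → ℝ) • s) y (X y)) x :=
    ContMDiffAt.clm_bundle_apply (hcovψs.contMDiffAt Filter.univ_mem) hX
  refine hcovX.congr ?_
  filter_upwards [ψ.eventuallyEq_one.eventuallyEq_nhds, hs] with y hy hsy
  rw [cov_congr hsy (hψs y) (hy.mono fun z hz ↦ by simp [hz])]

variable [ContMDiffVectorBundle ∞ F V 𝓘(ℝ, E)] [FiniteDimensional ℝ E] [FiniteDimensional ℝ F]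

theorem dualCov_smoothAt [T2Space M] (hcov : cov.ContMDiffCovariantDerivative ∞)
    (hξ : DualSmoothNear 𝓘(ℝ, E) F ξ x) (hX : SmoothAt 𝓘(ℝ, E) E X x) :
    DualSmoothAt 𝓘(ℝ, E) F (fun y ↦ dualCov cov ξ y (X y)) x := by
  refine dualSmoothAt_of_forall fun s hs ↦ ?_
  have h := (contMDiffAt_mvfderiv_apply (hξ.dualSmoothAt.apply hs.smoothAt) hX).sub
    (hξ.dualSmoothAt.apply (cov_smoothAt hcov hs hX))
  refine h.congr_of_eventuallyEq ?_
  filter_upwards [hξ, hs] with y hξy hsy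
  exact dualCov_apply cov hξy.dualMDiffAt hsy.mdifferentiableAt (X y)

theorem dualCov_ext {v : TangentSpace 𝓘(ℝ, E) x} {ξ₀ : V x →L[ℝ] ℝ}
    (hξ : DualMDiffAt 𝓘(ℝ, E) F ξ x)
    (h : ∀ s : Π x, V x, SmoothNear 𝓘(ℝ, E) F s x →
      mvfderiv 𝓘(ℝ, E) (fun y ↦ ξ y (s y)) x v - ξ x (cov s x v) = ξ₀ (s x)) :
    dualCov cov ξ x v = ξ₀ := by
  ext u
  obtain ⟨s, hs, rfl⟩ : ∃ s : Π x, V x, SmoothNear 𝓘(ℝ, E) F s x ∧ s x = u :=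
    ⟨extend F u, smoothNear_extend u, by simp⟩
  exact (dualCov_apply cov hξ hs.smoothAt.mdifferentiableAt v).trans (h s hs)

theorem dualCov_add (hξ : DualMDiffAt 𝓘(ℝ, E) F ξ x) (hζ : DualMDiffAt 𝓘(ℝ, E) F ζ x) :
    dualCov cov (ξ + ζ) x = dualCov cov ξ x + dualCov cov ζ x := by
  ext1 v
  refine dualCov_ext (mdifferentiableAt_add_section hξ hζ) fun s hs ↦ ?_
  have hs' := hs.smoothAt.mdifferentiableAt
  have hadd : mvfderiv 𝓘(ℝ, E) (fun y ↦ (ξ + ζ) y (s y)) x =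
      mvfderiv 𝓘(ℝ, E) (fun y ↦ ξ y (s y)) x + mvfderiv 𝓘(ℝ, E) (fun y ↦ ζ y (s y)) x :=
    mvfderiv_add (hξ.apply hs') (hζ.apply hs')
  rw [hadd]
  simp only [add_apply, Pi.add_apply, dualCov_apply cov hξ hs', dualCov_apply cov hζ hs']
  ring

theorem dualCov_smul {f : M → ℝ} (hf : MDifferentiableAt 𝓘(ℝ, E) 𝓘(ℝ, ℝ) f x)
    (hξ : DualMDiffAt 𝓘(ℝ, E) F ξ x) :
    dualCov cov (f • ξ) x =
      f x • dualCov cov ξ x + (mvfderiv 𝓘(ℝ, E) f x).smulRight (ξ x) := by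
  ext1 v
  refine dualCov_ext (MDifferentiableAt.smul_section hf hξ) fun s hs ↦ ?_
  have hs' := hs.smoothAt.mdifferentiableAt
  have hsmul : mvfderiv 𝓘(ℝ, E) (fun y ↦ (f • ξ) y (s y)) x =
      f x • mvfderiv 𝓘(ℝ, E) (fun y ↦ ξ y (s y)) x
        + (mvfderiv 𝓘(ℝ, E) f x).smulRight (ξ x (s x)) :=
    mvfderiv_smul hf (hξ.apply hs')
  rw [hsmul]
  simp only [add_apply, smul_apply, Pi.smul_apply', ContinuousLinearMap.smulRight_apply,
    dualCov_apply cov hξ hs', smul_eq_mul]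
  ring

/-- The connection `∇^∨` on `V^∨` dual to `∇`. -/
def dualConnection (cov : CovariantDerivative 𝓘(ℝ, E) F V) :
    CovariantDerivative 𝓘(ℝ, E) (F →L[ℝ] ℝ) (fun x ↦ V x →L[ℝ] Bundle.Trivial M ℝ x) where
  toFun := dualCov cov
  isCovariantDerivativeOnUniv :=
    { add := fun hξ hζ _ ↦ dualCov_add hξ hζ
      leibniz := fun hξ hf _ ↦ dualCov_smul hf hξ }

theorem dualCov_congr (hξ : DualSmoothAt 𝓘(ℝ, E) F ξ x) (hζ : DualSmoothAt 𝓘(ℝ, E) F ζ x)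
    (h : ∀ᶠ y in 𝓝 x, ξ y = ζ y) : dualCov cov ξ x = dualCov cov ζ x :=
  cov_congr (cov := dualConnection cov) hξ hζ h

theorem dualCov_dualCov_apply [T2Space M] (hcov : cov.ContMDiffCovariantDerivative ∞)
    (hξ : DualSmoothNear 𝓘(ℝ, E) F ξ x) (hX : SmoothAt 𝓘(ℝ, E) E X x)
    (hY : SmoothAt 𝓘(ℝ, E) E Y x) (hs : SmoothNear 𝓘(ℝ, E) F s x) :
    dualCov cov (fun y ↦ dualCov cov ξ y (Y y)) x (X x) (s x) =
      mvfderiv 𝓘(ℝ, E) (fun y ↦ mvfderiv 𝓘(ℝ, E) (fun z ↦ ξ z (s z)) y (Y y)) x (X x)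
        - mvfderiv 𝓘(ℝ, E) (fun y ↦ ξ y (cov s y (Y y))) x (X x)
        - (mvfderiv 𝓘(ℝ, E) (fun y ↦ ξ y (cov s y (X y))) x (Y x)
          - ξ x (cov (fun y ↦ cov s y (X y)) x (Y x))) := by
  have hξs := contMDiffAt_mvfderiv_apply (hξ.dualSmoothAt.apply hs.smoothAt) hY
  have hξcov := hξ.dualSmoothAt.apply (cov_smoothAt hcov hs hY)
  rw [dualCov_apply cov (dualCov_smoothAt hcov hξ hY).dualMDiffAt hs.smoothAt.mdifferentiableAt,
    dualCov_apply cov hξ.dualSmoothAt.dualMDiffAt (cov_smoothAt hcov hs hX).mdifferentiableAt]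
  congr 1
  rw [← sub_apply, ← mvfderiv_sub (hξs.mdifferentiableAt (by simp))
    (hξcov.mdifferentiableAt (by simp))]
  refine mvfderiv_congr ?_ _
  filter_upwards [hξ, hs] with y hξy hsy
  exact dualCov_apply cov hξy.dualMDiffAt hsy.mdifferentiableAt (Y y)

theorem dualCov_flat [T2Space M] (hcov : cov.ContMDiffCovariantDerivative ∞) (hflat : IsFlat cov)
    (hξ : DualSmoothNear 𝓘(ℝ, E) F ξ x) (hX : SmoothNear 𝓘(ℝ, E) E X x)
    (hY : SmoothNear 𝓘(ℝ, E) E Y x) :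
    dualCov cov (fun y ↦ dualCov cov ξ y (Y y)) x (X x)
      - dualCov cov (fun y ↦ dualCov cov ξ y (X y)) x (Y x)
      - dualCov cov ξ x (VectorField.mlieBracket 𝓘(ℝ, E) X Y x) = 0 := by
  have := FiniteDimensional.complete ℝ E
  suffices h : dualCov cov ξ x (VectorField.mlieBracket 𝓘(ℝ, E) X Y x) =
      dualCov cov (fun y ↦ dualCov cov ξ y (Y y)) x (X x)
        - dualCov cov (fun y ↦ dualCov cov ξ y (X y)) x (Y x) by
    rw [h, sub_self]
  refine dualCov_ext hξ.dualSmoothAt.dualMDiffAt fun s hs ↦ ?_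
  obtain ⟨U, hU, hUo, hxU⟩ := eventually_nhds_iff.1 ((hs.and hX).and hY)
  have hcurv := congrArg (ξ x) (hflat U X Y s hUo
    ((smoothOn_iff hUo).2 fun y hy ↦ (hU y hy).1.2) ((smoothOn_iff hUo).2 fun y hy ↦ (hU y hy).2)
    ((smoothOn_iff hUo).2 fun y hy ↦ (hU y hy).1.1) x hxU)
  rw [sub_apply, dualCov_dualCov_apply hcov hξ hX.smoothAt hY.smoothAt hs,
    dualCov_dualCov_apply hcov hξ hY.smoothAt hX.smoothAt hs,
    mvfderiv_mlieBracket (hξ.dualSmoothAt.apply hs.smoothAt) hX.smoothAt hY.smoothAt]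
  simp only [map_sub, map_zero] at hcurv
  linarith

end Connection

/-! ### The splitting of the tangent bundle of the total space -/

section TotalSpace

variable {E : Type*} [NormedAddCommGroup E] [NormedSpace ℝ E]
  {M : Type*} [TopologicalSpace M] [ChartedSpace E M]
  {F : Type*} [NormedAddCommGroup F] [NormedSpace ℝ F]
  {V : M → Type*} [TopologicalSpace (TotalSpace F V)]
  [∀ x, AddCommGroup (V x)] [∀ x, Module ℝ (V x)] [∀ x, TopologicalSpace (V x)]
  [FiberBundle F V] [VectorBundle ℝ F V] [ContMDiffVectorBundle ∞ F V 𝓘(ℝ, E)]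

variable (E F) in
/-- The model with corners of the total space of a vector bundle with fibre `F` over a manifold
modelled on `E`. -/
abbrev totI : ModelWithCorners ℝ (E × F) (ModelProd E F) := 𝓘(ℝ, E).prod 𝓘(ℝ, F)

/-- The coordinate along the fibres, in the trivialization `e`, on the total space. -/
def fibCoord (e : Trivialization F (TotalSpace.proj : TotalSpace F V → M)) (q : TotalSpace F V) :
    F := (e q).2

theorem contMDiffAt_fibCoord (e : Trivialization F (TotalSpace.proj : TotalSpace F V → M))
    [MemTrivializationAtlas e] {q : TotalSpace F V} (hq : q.proj ∈ e.baseSet) :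
    ContMDiffAt (totI E F) 𝓘(ℝ, F) ∞ (fibCoord e) q :=
  ((e.contMDiffAt_iff (IB := 𝓘(ℝ, E)) (e.mem_source.2 hq)).1 contMDiffAt_id).2

theorem contMDiffAt_fibre (x : M) (w : F) :
    ContMDiffAt 𝓘(ℝ, F) (totI E F) ∞
      (fun w : F ↦ TotalSpace.mk' F x ((trivializationAt F V x).symm x w)) w := by
  have hx := mem_baseSet_trivializationAt F V x
  rw [(trivializationAt F V x).contMDiffAt_iff (by simpa [Trivialization.mem_source] using hx)]
  refine ⟨contMDiffAt_const, contMDiffAt_id.congr_of_eventuallyEq (.of_forall fun w ↦ ?_)⟩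
  simp [Trivialization.apply_mk_symm _ hx]

omit [NormedSpace ℝ F] [∀ x, Module ℝ (V x)] [VectorBundle ℝ F V] in
theorem mk_symm_fibCoord (p : TotalSpace F V) :
    TotalSpace.mk' F p.proj ((trivializationAt F V p.proj).symm p.proj
      (trivializationAt F V p.proj p).2) = p := by
  have hx := mem_baseSet_trivializationAt F V p.proj
  conv_rhs => rw [← TotalSpace.eta p]
  congr 1
  exact Trivialization.symm_apply_apply_mk _ hx p.2

theorem dproj_fibDeriv (p : TotalSpace F V) (c : F) : dproj E p (fibDeriv (E := E) p c) = 0 := by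
  refine (mfderiv_comp_apply_of_eq
    (f := fun w : F ↦ TotalSpace.mk' F p.proj ((trivializationAt F V p.proj).symm p.proj w)) _
    ((contMDiffAt_proj V (n := ∞)).mdifferentiableAt (by simp))
    ((contMDiffAt_fibre p.proj _).mdifferentiableAt (by simp)) (mk_symm_fibCoord p) c).symm.trans ?_
  have : mfderiv 𝓘(ℝ, F) 𝓘(ℝ, E) (fun _ : F ↦ p.proj) (trivializationAt F V p.proj p).2 = 0 :=
    mfderiv_const
  exact congrArg (fun L : F →L[ℝ] E ↦ L c) this

theorem mvfderiv_fibDeriv {G : Type*} [NormedAddCommGroup G] [NormedSpace ℝ G]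
    {p : TotalSpace F V} {h : TotalSpace F V → G}
    (hh : MDifferentiableAt (totI E F) 𝓘(ℝ, G) h p) (c : F) :
    mvfderiv (totI E F) h p (fibDeriv p c) =
      fderiv ℝ (fun w ↦ h (TotalSpace.mk' F p.proj ((trivializationAt F V p.proj).symm p.proj w)))
        (trivializationAt F V p.proj p).2 c := by
  refine (mvfderiv_apply_mfderiv
    (f := fun w : F ↦ TotalSpace.mk' F p.proj ((trivializationAt F V p.proj).symm p.proj w))
    (mk_symm_fibCoord p) hh
    ((contMDiffAt_fibre p.proj _).mdifferentiableAt (by simp)) c).trans ?_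
  rw [mvfderiv, mfderiv_eq_fderiv]
  rfl

theorem mvfderiv_fibCoord_vert (p : TotalSpace F V) (u : V p.proj) :
    mvfderiv (totI E F) (fibCoord (trivializationAt F V p.proj)) p (vert p u) =
      (trivializationAt F V p.proj).continuousLinearMapAt ℝ p.proj u := by
  have hx := mem_baseSet_trivializationAt F V p.proj
  refine (mvfderiv_fibDeriv ((contMDiffAt_fibCoord _ hx).mdifferentiableAt (by simp)) _).trans ?_
  have : (fun w ↦ fibCoord (trivializationAt F V p.proj)
      (TotalSpace.mk' F p.proj ((trivializationAt F V p.proj).symm p.proj w))) = id := by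
    ext w
    simp [fibCoord, Trivialization.apply_mk_symm _ hx]
  rw [this, fderiv_id]
  rfl

theorem dproj_vert (p : TotalSpace F V) (u : V p.proj) : dproj E p (vert p u) = 0 :=
  dproj_fibDeriv p _

theorem mvfderiv_secDeriv {G : Type*} [NormedAddCommGroup G] [NormedSpace ℝ G]
    {p : TotalSpace F V} {h : TotalSpace F V → G}
    (hh : MDifferentiableAt (totI E F) 𝓘(ℝ, G) h p) (v : TangentSpace 𝓘(ℝ, E) p.proj) :
    mvfderiv (totI E F) h p (secDeriv p v) =
      mvfderiv 𝓘(ℝ, E) (fun x ↦ h (TotalSpace.mk' F x (extend F p.2 x))) p.proj v :=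
  mvfderiv_apply_mfderiv (f := fun x ↦ TotalSpace.mk' F x (extend F p.2 x)) (by simp) hh
    (smoothNear_extend p.2).smoothAt.mdifferentiableAt v

theorem dproj_secDeriv (p : TotalSpace F V) (v : TangentSpace 𝓘(ℝ, E) p.proj) :
    dproj E p (secDeriv p v) = v := by
  refine (mfderiv_comp_apply_of_eq (y := p) (f := fun x ↦ TotalSpace.mk' F x (extend F p.2 x))
    _ ((contMDiffAt_proj V (n := ∞)).mdifferentiableAt (by simp))
    (smoothNear_extend p.2).smoothAt.mdifferentiableAt (by simp) v).symm.trans ?_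
  exact congrArg (fun L : E →L[ℝ] E ↦ L v) (mfderiv_id (I := 𝓘(ℝ, E)) (x := p.proj))

theorem mvfderiv_fibCoord_secDeriv (p : TotalSpace F V) (v : TangentSpace 𝓘(ℝ, E) p.proj) :
    mvfderiv (totI E F) (fibCoord (trivializationAt F V p.proj)) p (secDeriv p v) = 0 := by
  have hx := mem_baseSet_trivializationAt F V p.proj
  rw [mvfderiv_secDeriv ((contMDiffAt_fibCoord _ hx).mdifferentiableAt (by simp)),
    mvfderiv_congr (g := fun _ ↦ (trivializationAt F V p.proj p).2), mvfderiv_const]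
  · rfl
  · filter_upwards [(trivializationAt F V p.proj).open_baseSet.mem_nhds hx] with x hx
    simp [fibCoord, extend, Trivialization.apply_mk_symm _ hx]

omit [∀ x, AddCommGroup (V x)] [∀ x, Module ℝ (V x)] [VectorBundle ℝ F V]
  [ContMDiffVectorBundle ∞ F V 𝓘(ℝ, E)] in
theorem mvfderiv_comp_proj {G : Type*} [NormedAddCommGroup G] [NormedSpace ℝ G]
    {p : TotalSpace F V} {f : M → G} (hf : MDifferentiableAt 𝓘(ℝ, E) 𝓘(ℝ, G) f p.proj)
    (w : TangentSpace (totI E F) p) :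
    mvfderiv (totI E F) (fun q : TotalSpace F V ↦ f q.proj) p w =
      mvfderiv 𝓘(ℝ, E) f p.proj (dproj E p w) :=
  (mvfderiv_apply_mfderiv rfl hf
    ((contMDiffAt_proj V (n := ∞)).mdifferentiableAt (by simp)) w).symm

theorem mvfderiv_extChartAt_totalSpace [IsManifold 𝓘(ℝ, E) ∞ M] {p q : TotalSpace F V}
    (hq : q.proj ∈ (trivializationAt F V p.proj).baseSet)
    (hq' : q.proj ∈ (chartAt E p.proj).source) (w : TangentSpace (totI E F) q) :
    mvfderiv (totI E F) (extChartAt (totI E F) p) q w =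
      (mvfderiv 𝓘(ℝ, E) (extChartAt 𝓘(ℝ, E) p.proj) q.proj (dproj E q w),
        mvfderiv (totI E F) (fibCoord (trivializationAt F V p.proj)) q w) := by
  set e := trivializationAt F V p.proj
  have hd : MDifferentiableAt (totI E F) 𝓘(ℝ, E × F) (extChartAt (totI E F) p) q := by
    refine mdifferentiableAt_extChartAt ?_
    rw [FiberBundle.chartedSpace_chartAt]
    simp [e, hq, hq', Trivialization.mem_source]
  have hev : ∀ᶠ z : TotalSpace F V in 𝓝 q, z.proj ∈ e.baseSet :=
    (FiberBundle.continuous_proj F V).continuousAt.eventually (e.open_baseSet.mem_nhds hq)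
  ext1
  · have := mvfderiv_clm_comp (ContinuousLinearMap.fst ℝ E F) hd w
    refine this.symm.trans ?_
    rw [← mvfderiv_comp_proj (mdifferentiableAt_extChartAt hq')]
    refine mvfderiv_congr ?_ w
    filter_upwards [hev] with z hz
    rw [FiberBundle.extChartAt]
    simp [e, Trivialization.coe_fst' _ hz]
  · have := mvfderiv_clm_comp (ContinuousLinearMap.snd ℝ E F) hd w
    refine this.symm.trans ?_
    refine mvfderiv_congr (.of_forall fun z ↦ ?_) w
    rw [FiberBundle.extChartAt]
    simp [e, fibCoord]

theorem eq_zero_of_dproj_of_fibCoord [IsManifold 𝓘(ℝ, E) ∞ M] {p : TotalSpace F V}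
    {w : TangentSpace (totI E F) p}
    (hproj : dproj E p w = 0)
    (hfib : mvfderiv (totI E F) (fibCoord (trivializationAt F V p.proj)) p w = 0) : w = 0 := by
  have h := mvfderiv_extChartAt_totalSpace (mem_baseSet_trivializationAt F V p.proj)
    (mem_chart_source E p.proj) w
  rw [hproj, hfib, map_zero] at h
  obtain ⟨L, hL⟩ := isInvertible_mfderiv_extChartAt (I := totI E F)
    (mem_extChartAt_source (I := totI E F) p)
  have h' : L w = 0 := by
    rw [← ContinuousLinearEquiv.coe_coe, hL]
    exact h
  exact L.injective (h'.trans (map_zero L).symm)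

/-- The fibrewise linear function on the total space that a section of the dual bundle defines. -/
def linFun (ξ : Π x, V x →L[ℝ] ℝ) (p : TotalSpace F V) : ℝ := ξ p.proj p.2

omit [ContMDiffVectorBundle ∞ F V 𝓘(ℝ, E)] in
theorem contMDiffAt_linFun {ξ : Π x, V x →L[ℝ] ℝ} {p : TotalSpace F V}
    (hξ : DualSmoothAt 𝓘(ℝ, E) F ξ p.proj) :
    ContMDiffAt (totI E F) 𝓘(ℝ, ℝ) ∞ (linFun (F := F) ξ) p := by
  have hξπ : ContMDiffAt (totI E F) (𝓘(ℝ, E).prod 𝓘(ℝ, F →L[ℝ] ℝ)) ∞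
      (fun q : TotalSpace F V ↦ TotalSpace.mk' (F →L[ℝ] ℝ)
        (E := fun x ↦ V x →L[ℝ] Bundle.Trivial M ℝ x) q.proj (ξ q.proj)) p :=
    ContMDiffAt.comp p hξ (contMDiffAt_proj V)
  have htaut : ContMDiffAt (totI E F) (totI E F) ∞
      (fun q : TotalSpace F V ↦ TotalSpace.mk' F q.proj q.2) p := contMDiffAt_id
  exact (contMDiffAt_totalSpace.1 (ContMDiffAt.clm_bundle_apply (F₁ := F) (F₂ := ℝ)
    (E₂ := Bundle.Trivial M ℝ) hξπ htaut)).2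

theorem mvfderiv_linFun_vert {ξ : Π x, V x →L[ℝ] ℝ} {p : TotalSpace F V}
    (hξ : DualSmoothAt 𝓘(ℝ, E) F ξ p.proj) (u : V p.proj) :
    mvfderiv (totI E F) (linFun ξ) p (vert p u) = ξ p.proj u := by
  have hx := mem_baseSet_trivializationAt F V p.proj
  refine (mvfderiv_fibDeriv ((contMDiffAt_linFun hξ).mdifferentiableAt (by simp)) _).trans ?_
  have : (fun w ↦ linFun ξ
      (TotalSpace.mk' F p.proj ((trivializationAt F V p.proj).symm p.proj w))) =
      (ξ p.proj).comp ((trivializationAt F V p.proj).symmL ℝ p.proj) := by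
    ext w
    simp [linFun, Trivialization.symmL_apply _ hx]
  rw [this, ContinuousLinearMap.fderiv]
  exact congrArg (ξ p.proj) (Trivialization.symmL_continuousLinearMapAt _ hx u)

variable [∀ x, IsTopologicalAddGroup (V x)] [∀ x, ContinuousSMul ℝ (V x)]
  {cov : CovariantDerivative 𝓘(ℝ, E) F V}

theorem connProj_vert (cov : CovariantDerivative 𝓘(ℝ, E) F V) (p : TotalSpace F V)
    (u : V p.proj) : connProj cov p (vert p u) = u := by
  have hx := mem_baseSet_trivializationAt F V p.proj
  have h := mvfderiv_fibCoord_vert (E := E) p u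
  unfold fibCoord at h
  simp only [connProj, add_apply, ContinuousLinearMap.coe_comp, Function.comp_apply, dproj_vert,
    map_zero, add_zero, h]
  exact Trivialization.symmL_continuousLinearMapAt _ hx u

theorem connProj_secDeriv (cov : CovariantDerivative 𝓘(ℝ, E) F V) (p : TotalSpace F V)
    (v : TangentSpace 𝓘(ℝ, E) p.proj) :
    connProj cov p (secDeriv p v) = cov (extend F p.2) p.proj v := by
  have h := mvfderiv_fibCoord_secDeriv p v
  unfold fibCoord at h
  simp only [connProj, add_apply, ContinuousLinearMap.coe_comp, Function.comp_apply,
    dproj_secDeriv, map_zero, zero_add, h]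

theorem connProj_horLift (cov : CovariantDerivative 𝓘(ℝ, E) F V) (p : TotalSpace F V)
    (v : TangentSpace 𝓘(ℝ, E) p.proj) : connProj cov p (horLift cov p v) = 0 := by
  simp [horLift, connProj_vert, connProj_secDeriv]

theorem dproj_horLift (cov : CovariantDerivative 𝓘(ℝ, E) F V) (p : TotalSpace F V)
    (v : TangentSpace 𝓘(ℝ, E) p.proj) : dproj E p (horLift cov p v) = v := by
  simp [horLift, dproj_vert, dproj_secDeriv]

variable [IsManifold 𝓘(ℝ, E) ∞ M]

theorem vert_connProj_add_horLift_dproj (cov : CovariantDerivative 𝓘(ℝ, E) F V)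
    (p : TotalSpace F V) (w : TangentSpace (totI E F) p) :
    vert p (connProj cov p w) + horLift cov p (dproj E p w) = w := by
  have hx := mem_baseSet_trivializationAt F V p.proj
  rw [← sub_eq_zero]
  refine eq_zero_of_dproj_of_fibCoord ?_ ?_
  · simp [dproj_vert, dproj_horLift]
  · have h : connProj cov p w = (trivializationAt F V p.proj).symmL ℝ p.proj
        (mvfderiv (totI E F) (fibCoord (trivializationAt F V p.proj)) p w)
        + cov (extend F p.2) p.proj (dproj E p w) := rfl
    simp only [horLift, map_sub, map_add, sub_apply, ContinuousLinearMap.coe_comp,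
      Function.comp_apply, mvfderiv_fibCoord_vert, mvfderiv_fibCoord_secDeriv, h]
    rw [Trivialization.continuousLinearMapAt_symmL _ hx]
    abel

variable [FiniteDimensional ℝ E] [FiniteDimensional ℝ F]

theorem mvfderiv_linFun_horLift {ξ : Π x, V x →L[ℝ] ℝ} {p : TotalSpace F V}
    (hξ : DualSmoothAt 𝓘(ℝ, E) F ξ p.proj) (v : TangentSpace 𝓘(ℝ, E) p.proj) :
    mvfderiv (totI E F) (linFun ξ) p (horLift cov p v) = dualCov cov ξ p.proj v p.2 := by
  have h := dualCov_apply cov hξ.dualMDiffAt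
    (smoothNear_extend (I := 𝓘(ℝ, E)) (F := F) p.2).smoothAt.mdifferentiableAt v
  rw [extend_apply_self] at h
  rw [h, horLift, sub_apply, map_sub, ContinuousLinearMap.coe_comp, Function.comp_apply,
    mvfderiv_linFun_vert hξ,
    mvfderiv_secDeriv ((contMDiffAt_linFun hξ).mdifferentiableAt (by simp))]
  rfl

theorem apply_connProj {ξ : Π x, V x →L[ℝ] ℝ} {p : TotalSpace F V}
    (hξ : DualSmoothAt 𝓘(ℝ, E) F ξ p.proj) (w : TangentSpace (totI E F) p) :
    ξ p.proj (connProj cov p w) =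
      mvfderiv (totI E F) (linFun ξ) p w - dualCov cov ξ p.proj (dproj E p w) p.2 := by
  conv_rhs => rw [← vert_connProj_add_horLift_dproj cov p w]
  simp [dproj_vert, dproj_horLift, mvfderiv_linFun_vert hξ, mvfderiv_linFun_horLift hξ]

end TotalSpace

/-! ### Vector fields and one-forms lifted to the total space -/

section Lifts

variable {E : Type*} [NormedAddCommGroup E] [NormedSpace ℝ E]
  {M : Type*} [TopologicalSpace M] [ChartedSpace E M]
  {F : Type*} [NormedAddCommGroup F] [NormedSpace ℝ F]
  {V : M → Type*} [TopologicalSpace (TotalSpace F V)]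
  [∀ x, AddCommGroup (V x)] [∀ x, Module ℝ (V x)] [∀ x, TopologicalSpace (V x)]
  [FiberBundle F V] [VectorBundle ℝ F V]
  {s t : Π x, V x} {ξ : Π x, V x →L[ℝ] ℝ} {p : TotalSpace F V}
  {Y Z : Π x : M, TangentSpace 𝓘(ℝ, E) x}

/-- The section of `V^∨` with constant coordinates `l` in the trivialization `e`. -/
def coordForm (e : Trivialization F (TotalSpace.proj : TotalSpace F V → M))
    [MemTrivializationAtlas e] (l : F →L[ℝ] ℝ) (x : M) : V x →L[ℝ] ℝ :=
  l.comp (e.continuousLinearMapAt ℝ x)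

theorem coordForm_apply (e : Trivialization F (TotalSpace.proj : TotalSpace F V → M))
    [MemTrivializationAtlas e] (l : F →L[ℝ] ℝ) {x : M} (hx : x ∈ e.baseSet) (v : V x) :
    coordForm e l x v = l (e ⟨x, v⟩).2 :=
  congrArg l (congrFun (e.coe_linearMapAt_of_mem (R := ℝ) hx) v)

omit [NormedSpace ℝ F] [∀ x, AddCommGroup (V x)] [∀ x, Module ℝ (V x)] [VectorBundle ℝ F V] in
theorem eventually_proj {P : M → Prop} (h : ∀ᶠ x in 𝓝 p.proj, P x) :
    ∀ᶠ q : TotalSpace F V in 𝓝 p, P q.proj :=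
  (FiberBundle.continuous_proj F V).continuousAt.eventually h

variable [ContMDiffVectorBundle ∞ F V 𝓘(ℝ, E)]

theorem mvfderiv_linFun_coordForm (e : Trivialization F (TotalSpace.proj : TotalSpace F V → M))
    [MemTrivializationAtlas e] (l : F →L[ℝ] ℝ) (hp : p.proj ∈ e.baseSet)
    (w : TangentSpace (totI E F) p) :
    mvfderiv (totI E F) (linFun (coordForm e l)) p w =
      l (mvfderiv (totI E F) (fibCoord e) p w) := by
  rw [← mvfderiv_clm_comp l ((contMDiffAt_fibCoord e hp).mdifferentiableAt (by simp))]
  refine mvfderiv_congr ?_ w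
  filter_upwards [eventually_proj (e.open_baseSet.mem_nhds hp)] with q hq
  exact coordForm_apply e l hq q.2

/-- The vertical vector field on the total space defined by a section of `V`. -/
def vertField (s : Π x, V x) (p : TotalSpace F V) : TangentSpace (totI E F) p :=
  vert p (s p.proj)

/-- The pull-back `(dπ)^∨ η` of a one-form to the total space. -/
def projForm (η : Π x : M, TangentSpace 𝓘(ℝ, E) x →L[ℝ] ℝ) (p : TotalSpace F V) :
    TangentSpace (totI E F) p →L[ℝ] ℝ :=
  (η p.proj).comp (dproj E p)

theorem mvfderiv_mvfderiv_linFun_vertField (hξ : DualSmoothNear 𝓘(ℝ, E) F ξ p.proj)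
    (hs : SmoothAt 𝓘(ℝ, E) F s p.proj) (w : TangentSpace (totI E F) p) :
    mvfderiv (totI E F) (fun q ↦ mvfderiv (totI E F) (linFun ξ) q (vertField s q)) p w =
      mvfderiv 𝓘(ℝ, E) (fun x ↦ ξ x (s x)) p.proj (dproj E p w) := by
  rw [← mvfderiv_comp_proj ((hξ.dualSmoothAt.apply hs).mdifferentiableAt (by simp))]
  refine mvfderiv_congr ?_ w
  filter_upwards [eventually_proj hξ] with q hq
  exact mvfderiv_linFun_vert hq _

variable [FiniteDimensional ℝ F]

theorem dualSmoothNear_coordForm (e : Trivialization F (TotalSpace.proj : TotalSpace F V → M))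
    [MemTrivializationAtlas e] (l : F →L[ℝ] ℝ) {x : M} (hx : x ∈ e.baseSet) :
    DualSmoothNear 𝓘(ℝ, E) F (coordForm e l) x := by
  filter_upwards [e.open_baseSet.mem_nhds hx] with y hy
  refine dualSmoothAt_of_forall fun s hs ↦ ?_
  have h := l.contMDiff.contMDiffAt.comp y ((e.contMDiffAt_section_iff hy).1 hs.smoothAt)
  refine h.congr_of_eventuallyEq ?_
  filter_upwards [e.open_baseSet.mem_nhds hy] with z hz
  exact coordForm_apply e l hz _

variable [IsManifold 𝓘(ℝ, E) ∞ M]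

theorem eq_of_dproj_of_linFun {w w' : TangentSpace (totI E F) p} (h : dproj E p w = dproj E p w')
    (hlin : ∀ ξ : Π x, V x →L[ℝ] ℝ, DualSmoothNear 𝓘(ℝ, E) F ξ p.proj →
      mvfderiv (totI E F) (linFun ξ) p w = mvfderiv (totI E F) (linFun ξ) p w') : w = w' := by
  have hp := mem_baseSet_trivializationAt F V p.proj
  refine sub_eq_zero.1 (eq_zero_of_dproj_of_fibCoord (by rw [map_sub, h, sub_self]) ?_)
  refine SeparatingDual.eq_zero_of_forall_dual_eq_zero (R := ℝ) fun l ↦ ?_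
  rw [← mvfderiv_linFun_coordForm _ l hp, map_sub, hlin _ (dualSmoothNear_coordForm _ l hp),
    sub_self]

theorem smoothAt_of_dproj_of_linFun {A : Π p : TotalSpace F V, TangentSpace (totI E F) p}
    (hproj : ContMDiffAt (totI E F) 𝓘(ℝ, E) ∞
      (fun q ↦ mvfderiv 𝓘(ℝ, E) (extChartAt 𝓘(ℝ, E) p.proj) q.proj (dproj E q (A q))) p)
    (hlin : ∀ ξ : Π x, V x →L[ℝ] ℝ, DualSmoothNear 𝓘(ℝ, E) F ξ p.proj →
      ContMDiffAt (totI E F) 𝓘(ℝ, ℝ) ∞ (fun q ↦ mvfderiv (totI E F) (linFun ξ) q (A q)) p) :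
    SmoothAt (totI E F) (E × F) A p := by
  set e := trivializationAt F V p.proj
  have hp : p.proj ∈ e.baseSet := mem_baseSet_trivializationAt F V p.proj
  have hev := eventually_proj (e.open_baseSet.mem_nhds hp)
  have hfib : ContMDiffAt (totI E F) 𝓘(ℝ, F) ∞
      (fun q ↦ mvfderiv (totI E F) (fibCoord e) q (A q)) p :=
    contMDiffAt_of_forall_dual fun l ↦
      (hlin _ (dualSmoothNear_coordForm e l hp)).congr_of_eventuallyEq
        (hev.mono fun q hq ↦ (mvfderiv_linFun_coordForm e l hq (A q)).symm)
  refine smoothAt_vectorField_iff.2 ((hproj.prodMk_space hfib).congr_of_eventuallyEq ?_)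
  filter_upwards [hev,
    eventually_proj ((chartAt E p.proj).open_source.mem_nhds (mem_chart_source E p.proj))]
    with q hq hq'
  exact mvfderiv_extChartAt_totalSpace hq hq' (A q)

theorem smoothAt_vertField (hs : SmoothAt 𝓘(ℝ, E) F s p.proj) :
    SmoothAt (totI E F) (E × F) (vertField (E := E) s) p := by
  refine smoothAt_of_dproj_of_linFun ?_ fun ξ hξ ↦ ?_
  · simp only [vertField, dproj_vert, map_zero]
    exact contMDiffAt_const
  · refine ((hξ.dualSmoothAt.apply hs).comp p (contMDiffAt_proj V)).congr_of_eventuallyEq ?_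
    filter_upwards [eventually_proj hξ] with q hq
    exact mvfderiv_linFun_vert hq _

omit [FiniteDimensional ℝ F] in
theorem contMDiffAt_dproj_apply {A : Π p : TotalSpace F V, TangentSpace (totI E F) p}
    (hA : SmoothAt (totI E F) (E × F) A p) :
    ContMDiffAt (totI E F) (𝓘(ℝ, E).prod 𝓘(ℝ, E)) ∞
      (fun q ↦ TotalSpace.mk' E (E := (TangentSpace 𝓘(ℝ, E) : M → Type _)) q.proj
        (dproj E q (A q))) p :=
  ContMDiffAt.clm_apply_of_inCoordinates
    ((contMDiffAt_proj V (n := ∞)).mfderiv_const (by simp)) hA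
    (contMDiffAt_proj V)

theorem dualSmoothAt_projForm [FiniteDimensional ℝ E]
    {η : Π x : M, TangentSpace 𝓘(ℝ, E) x →L[ℝ] ℝ} (hη : DualSmoothAt 𝓘(ℝ, E) E η p.proj) :
    DualSmoothAt (totI E F) (E × F) (projForm (F := F) (V := V) η) p := by
  refine dualSmoothAt_of_forall fun A hA ↦ ?_
  have hη' : ContMDiffAt (totI E F) (𝓘(ℝ, E).prod 𝓘(ℝ, E →L[ℝ] ℝ)) ∞
      (fun q : TotalSpace F V ↦ TotalSpace.mk' (E →L[ℝ] ℝ)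
        (E := fun x : M ↦ TangentSpace 𝓘(ℝ, E) x →L[ℝ] Bundle.Trivial M ℝ x) q.proj (η q.proj)) p :=
    ContMDiffAt.comp p hη (contMDiffAt_proj V)
  exact (contMDiffAt_totalSpace.1 (ContMDiffAt.clm_bundle_apply (F₁ := E) (F₂ := ℝ)
    (E₂ := Bundle.Trivial M ℝ) hη' (contMDiffAt_dproj_apply hA.smoothAt))).2

theorem dproj_mlieBracket [CompleteSpace E] {A A' : Π p : TotalSpace F V, TangentSpace (totI E F) p}
    (hA : SmoothAt (totI E F) (E × F) A p) (hA' : SmoothAt (totI E F) (E × F) A' p)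
    (hY : SmoothAt 𝓘(ℝ, E) E Y p.proj) (hZ : SmoothAt 𝓘(ℝ, E) E Z p.proj)
    (hAY : ∀ q, dproj E q (A q) = Y q.proj) (hAZ : ∀ q, dproj E q (A' q) = Z q.proj) :
    dproj E p (VectorField.mlieBracket (totI E F) A A' p) =
      VectorField.mlieBracket 𝓘(ℝ, E) Y Z p.proj := by
  refine eq_of_forall_mvfderiv_eq (I := 𝓘(ℝ, E)) fun f hf ↦ ?_
  have hfp := hf.self_of_nhds
  have iterate {A A' : Π p : TotalSpace F V, TangentSpace (totI E F) p}
      {Y Z : Π x : M, TangentSpace 𝓘(ℝ, E) x} (hY : SmoothAt 𝓘(ℝ, E) E Y p.proj)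
      (hAY : ∀ q, dproj E q (A q) = Y q.proj) (hAZ : ∀ q, dproj E q (A' q) = Z q.proj) :
      mvfderiv (totI E F) (fun q ↦ mvfderiv (totI E F)
        (fun q : TotalSpace F V ↦ f q.proj) q (A q)) p (A' p) =
      mvfderiv 𝓘(ℝ, E) (fun x ↦ mvfderiv 𝓘(ℝ, E) f x (Y x)) p.proj (Z p.proj) := by
    rw [← hAZ, ← mvfderiv_comp_proj
      ((contMDiffAt_mvfderiv_apply hfp hY).mdifferentiableAt (by simp))]
    refine mvfderiv_congr ?_ _
    filter_upwards [eventually_proj hf] with q hq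
    rw [mvfderiv_comp_proj (hq.mdifferentiableAt (by simp)), hAY]
  have hfπ : ContMDiffAt (totI E F) 𝓘(ℝ, ℝ) ∞ (fun q : TotalSpace F V ↦ f q.proj) p :=
    hfp.comp p (contMDiffAt_proj V)
  rw [← mvfderiv_comp_proj (hfp.mdifferentiableAt (by simp)), mvfderiv_mlieBracket hfπ hA hA',
    mvfderiv_mlieBracket hfp hY hZ]
  exact congrArg₂ _ (iterate hZ hAZ hAY) (iterate hY hAY hAZ)

theorem smoothAt_zero (x : M) : SmoothAt 𝓘(ℝ, E) E (fun y : M ↦ (0 : TangentSpace 𝓘(ℝ, E) y)) x :=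
  (contMDiff_zeroSection ℝ (TangentSpace 𝓘(ℝ, E) : M → Type _)).contMDiffAt

theorem mlieBracket_vertField [CompleteSpace E] (hs : SmoothAt 𝓘(ℝ, E) F s p.proj)
    (ht : SmoothAt 𝓘(ℝ, E) F t p.proj) :
    VectorField.mlieBracket (totI E F) (vertField s) (vertField t) p = 0 := by
  refine eq_of_dproj_of_linFun ?_ fun ξ hξ ↦ ?_
  · rw [dproj_mlieBracket (Y := fun _ ↦ 0) (Z := fun _ ↦ 0) (smoothAt_vertField hs)
      (smoothAt_vertField ht) (smoothAt_zero _) (smoothAt_zero _)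
      (fun q ↦ dproj_vert q _) (fun q ↦ dproj_vert q _), map_zero]
    exact congrFun (VectorField.mlieBracket_zero_right (I := 𝓘(ℝ, E))) p.proj
  · rw [mvfderiv_mlieBracket (contMDiffAt_linFun hξ.dualSmoothAt) (smoothAt_vertField hs)
      (smoothAt_vertField ht), mvfderiv_mvfderiv_linFun_vertField hξ hs,
      mvfderiv_mvfderiv_linFun_vertField hξ ht]
    simp [vertField, dproj_vert]

variable [FiniteDimensional ℝ E] [∀ x, IsTopologicalAddGroup (V x)]
  [∀ x, ContinuousSMul ℝ (V x)] {cov : CovariantDerivative 𝓘(ℝ, E) F V}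

/-- The horizontal lift of a vector field. -/
def horField (cov : CovariantDerivative 𝓘(ℝ, E) F V) (Y : Π x : M, TangentSpace 𝓘(ℝ, E) x)
    (p : TotalSpace F V) : TangentSpace (totI E F) p :=
  horLift cov p (Y p.proj)

/-- The one-form `D^∨ ξ` on the total space defined by a section `ξ` of `V^∨` and the
connection. -/
def connForm (cov : CovariantDerivative 𝓘(ℝ, E) F V) (ξ : Π x, V x →L[ℝ] ℝ)
    (p : TotalSpace F V) : TangentSpace (totI E F) p →L[ℝ] ℝ :=
  (ξ p.proj).comp (connProj cov p)

theorem mvfderiv_mvfderiv_linFun_horField (hξ : DualSmoothNear 𝓘(ℝ, E) F ξ p.proj)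
    (w : TangentSpace (totI E F) p) :
    mvfderiv (totI E F) (fun q ↦ mvfderiv (totI E F) (linFun ξ) q (horField cov Y q)) p w =
      mvfderiv (totI E F) (linFun fun x ↦ dualCov cov ξ x (Y x)) p w :=
  mvfderiv_congr ((eventually_proj hξ).mono fun _ hq ↦ mvfderiv_linFun_horLift hq _) w

variable [T2Space M] (hcov : cov.ContMDiffCovariantDerivative ∞)
include hcov

theorem smoothAt_horField (hY : SmoothAt 𝓘(ℝ, E) E Y p.proj) :
    SmoothAt (totI E F) (E × F) (horField cov Y) p := by
  refine smoothAt_of_dproj_of_linFun ?_ fun ξ hξ ↦ ?_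
  · simp only [horField, dproj_horLift]
    exact (smoothAt_vectorField_iff.1 hY).comp p (contMDiffAt_proj V)
  · refine (contMDiffAt_linFun (dualCov_smoothAt hcov hξ hY)).congr_of_eventuallyEq ?_
    filter_upwards [eventually_proj hξ] with q hq
    exact mvfderiv_linFun_horLift hq _

theorem contMDiffAt_dualCov_dproj (hξ : DualSmoothNear 𝓘(ℝ, E) F ξ p.proj)
    {A : Π p : TotalSpace F V, TangentSpace (totI E F) p}
    (hA : SmoothAt (totI E F) (E × F) A p) :
    ContMDiffAt (totI E F) 𝓘(ℝ, ℝ) ∞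
      (fun q ↦ dualCov cov ξ q.proj (dproj E q (A q)) q.2) p := by
  let e := trivializationAt E (TangentSpace 𝓘(ℝ, E) : M → Type _) p.proj
  have hp : p.proj ∈ e.baseSet := mem_baseSet_trivializationAt E _ p.proj
  let b := Module.finBasis ℝ E
  have hcoord (i) : ContMDiffAt (totI E F) 𝓘(ℝ, ℝ) ∞
      (fun q ↦ b.coord i (e ⟨q.proj, dproj E q (A q)⟩).2) p :=
    (LinearMap.toContinuousLinearMap (b.coord i)).contMDiff.contMDiffAt.comp p
      (contMDiffAt_totalSpace.1 (contMDiffAt_dproj_apply hA)).2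
  have hframe (i) : ContMDiffAt (totI E F) 𝓘(ℝ, ℝ) ∞
      (linFun fun x ↦ dualCov cov ξ x (e.symm x (b i))) p :=
    contMDiffAt_linFun (dualCov_smoothAt hcov hξ (smoothAt_symm e hp (b i)))
  refine (ContMDiffAt.sum (t := Finset.univ) fun i _ ↦
    (hcoord i).smul (hframe i)).congr_of_eventuallyEq ?_
  filter_upwards [eventually_proj (e.open_baseSet.mem_nhds hp)] with q hq
  have hexpand : dproj E q (A q) =
      ∑ i, b.coord i (e ⟨q.proj, dproj E q (A q)⟩).2 • e.symm q.proj (b i) := by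
    simp only [← e.symmL_apply (R := ℝ) hq, ← map_smul, ← map_sum]
    simp only [Module.Basis.coord_apply, b.sum_repr]
    rw [e.symmL_apply hq]
    exact (e.symm_proj_apply ⟨q.proj, dproj E q (A q)⟩ hq).symm
  conv_lhs => rw [hexpand]
  simp [linFun]

theorem dualSmoothAt_connForm (hξ : DualSmoothNear 𝓘(ℝ, E) F ξ p.proj) :
    DualSmoothAt (totI E F) (E × F) (connForm cov ξ) p := by
  refine dualSmoothAt_of_forall fun A hA ↦ ?_
  refine ((contMDiffAt_mvfderiv_apply (contMDiffAt_linFun hξ.dualSmoothAt) hA.smoothAt).sub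
    (contMDiffAt_dualCov_dproj hcov hξ hA.smoothAt)).congr_of_eventuallyEq ?_
  filter_upwards [eventually_proj hξ] with q hq
  exact apply_connProj hq (A q)

theorem mlieBracket_horField_vertField (hY : SmoothAt 𝓘(ℝ, E) E Y p.proj)
    (hs : SmoothAt 𝓘(ℝ, E) F s p.proj) :
    VectorField.mlieBracket (totI E F) (horField cov Y) (vertField s) p =
      vertField (fun x ↦ cov s x (Y x)) p := by
  have := FiniteDimensional.complete ℝ E
  refine eq_of_dproj_of_linFun ?_ fun ξ hξ ↦ ?_
  · rw [dproj_mlieBracket (smoothAt_horField hcov hY) (smoothAt_vertField hs) hY (smoothAt_zero _)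
      (fun q ↦ dproj_horLift cov q _) (fun q ↦ dproj_vert q _), vertField, dproj_vert]
    exact congrFun (VectorField.mlieBracket_zero_right (I := 𝓘(ℝ, E)) (W := Y)) p.proj
  · rw [mvfderiv_mlieBracket (contMDiffAt_linFun hξ.dualSmoothAt) (smoothAt_horField hcov hY)
      (smoothAt_vertField hs), mvfderiv_mvfderiv_linFun_vertField hξ hs,
      mvfderiv_mvfderiv_linFun_horField hξ, horField, vertField, vertField, dproj_horLift,
      mvfderiv_linFun_vert (dualCov_smoothAt hcov hξ hY), mvfderiv_linFun_vert hξ.dualSmoothAt,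
      dualCov_apply cov hξ.dualSmoothAt.dualMDiffAt hs.mdifferentiableAt, sub_sub_cancel]

theorem mlieBracket_horField (hp : p.2 = 0) (hY : SmoothAt 𝓘(ℝ, E) E Y p.proj)
    (hZ : SmoothAt 𝓘(ℝ, E) E Z p.proj) :
    VectorField.mlieBracket (totI E F) (horField cov Y) (horField cov Z) p =
      horField cov (VectorField.mlieBracket 𝓘(ℝ, E) Y Z) p := by
  have := FiniteDimensional.complete ℝ E
  refine eq_of_dproj_of_linFun ?_ fun ξ hξ ↦ ?_
  · rw [dproj_mlieBracket (smoothAt_horField hcov hY) (smoothAt_horField hcov hZ) hY hZ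
      (fun q ↦ dproj_horLift cov q _) (fun q ↦ dproj_horLift cov q _), horField, dproj_horLift]
  · rw [mvfderiv_mlieBracket (contMDiffAt_linFun hξ.dualSmoothAt) (smoothAt_horField hcov hY)
      (smoothAt_horField hcov hZ), mvfderiv_mvfderiv_linFun_horField hξ,
      mvfderiv_mvfderiv_linFun_horField hξ, horField, horField, horField,
      mvfderiv_linFun_horLift (dualCov_smoothAt hcov hξ hY),
      mvfderiv_linFun_horLift (dualCov_smoothAt hcov hξ hZ),
      mvfderiv_linFun_horLift hξ.dualSmoothAt, hp]
    simp only [map_zero, sub_zero]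

end Lifts

/-! ### Courant brackets of lifted sections -/

section CourantLifts

variable {E : Type*} [NormedAddCommGroup E] [NormedSpace ℝ E]
  {M : Type*} [TopologicalSpace M] [ChartedSpace E M]
  {F : Type*} [NormedAddCommGroup F] [NormedSpace ℝ F]
  {V : M → Type*} [TopologicalSpace (TotalSpace F V)]
  [∀ x, AddCommGroup (V x)] [∀ x, Module ℝ (V x)] [∀ x, TopologicalSpace (V x)]
  [∀ x, IsTopologicalAddGroup (V x)] [∀ x, ContinuousSMul ℝ (V x)]
  [FiberBundle F V] [VectorBundle ℝ F V]
  {cov : CovariantDerivative 𝓘(ℝ, E) F V} {p : TotalSpace F V}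
  {A C : Π x : M, Gen (TangentSpace 𝓘(ℝ, E) : M → Type _) x} {a c : Π x, Gen V x}

/-- The lift to the total space of a section of `T_M ⊕ T_M^∨`: horizontal on vector fields, the
pull-back on one-forms. -/
def liftT (cov : CovariantDerivative 𝓘(ℝ, E) F V)
    (A : Π x : M, Gen (TangentSpace 𝓘(ℝ, E) : M → Type _) x) (p : TotalSpace F V) :
    Gen (TangentSpace (totI E F) : TotalSpace F V → Type _) p :=
  (horField cov (fun x ↦ (A x).1) p, projForm (fun x ↦ (A x).2) p)

/-- The lift to the total space of a section of `V ⊕ V^∨`: vertical on sections of `V`, and `D^∨` on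
sections of `V^∨`. -/
def liftV (cov : CovariantDerivative 𝓘(ℝ, E) F V) (a : Π x, Gen V x) (p : TotalSpace F V) :
    Gen (TangentSpace (totI E F) : TotalSpace F V → Type _) p :=
  (vertField (fun x ↦ (a x).1) p, connForm cov (fun x ↦ (a x).2) p)

theorem liftT_fst (p : TotalSpace F V) : (liftT cov A p).1 = horField cov (fun x ↦ (A x).1) p :=
  rfl

theorem liftV_fst (p : TotalSpace F V) : (liftV cov a p).1 = vertField (fun x ↦ (a x).1) p :=
  rfl

variable [ContMDiffVectorBundle ∞ F V 𝓘(ℝ, E)]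

theorem liftT_snd_horField (Y : Π x : M, TangentSpace 𝓘(ℝ, E) x) (p : TotalSpace F V) :
    (liftT cov A p).2 (horField cov Y p) = (A p.proj).2 (Y p.proj) :=
  congrArg (A p.proj).2 (dproj_horLift cov p _)

theorem liftT_snd_vertField (s : Π x, V x) (p : TotalSpace F V) :
    (liftT cov A p).2 (vertField s p) = 0 :=
  (congrArg (A p.proj).2 (dproj_vert p _)).trans (map_zero _)

theorem liftV_snd_horField (Y : Π x : M, TangentSpace 𝓘(ℝ, E) x) (p : TotalSpace F V) :
    (liftV cov a p).2 (horField cov Y p) = 0 :=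
  (congrArg (a p.proj).2 (connProj_horLift cov p _)).trans (map_zero _)

theorem liftV_snd_vertField (s : Π x, V x) (p : TotalSpace F V) :
    (liftV cov a p).2 (vertField s p) = (a p.proj).2 (s p.proj) :=
  congrArg (a p.proj).2 (connProj_vert cov p _)

theorem mvfderiv_comp_proj_horField {f : M → ℝ}
    (hf : MDifferentiableAt 𝓘(ℝ, E) 𝓘(ℝ, ℝ) f p.proj) (Y : Π x : M, TangentSpace 𝓘(ℝ, E) x) :
    mvfderiv (totI E F) (fun q : TotalSpace F V ↦ f q.proj) p (horField cov Y p) =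
      mvfderiv 𝓘(ℝ, E) f p.proj (Y p.proj) :=
  (mvfderiv_comp_proj hf _).trans (congrArg _ (dproj_horLift cov p _))

omit [∀ x, IsTopologicalAddGroup (V x)] [∀ x, ContinuousSMul ℝ (V x)] in
theorem mvfderiv_comp_proj_vertField {f : M → ℝ}
    (hf : MDifferentiableAt 𝓘(ℝ, E) 𝓘(ℝ, ℝ) f p.proj) (s : Π x, V x) :
    mvfderiv (totI E F) (fun q : TotalSpace F V ↦ f q.proj) p (vertField s p) = 0 :=
  (mvfderiv_comp_proj hf _).trans ((congrArg _ (dproj_vert p _)).trans (map_zero _))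

variable [IsManifold 𝓘(ℝ, E) ∞ M]

theorem eq_of_vertField_of_horField {φ ψ : TangentSpace (totI E F) p →L[ℝ] ℝ}
    (hV : ∀ s : Π x, V x, SmoothNear 𝓘(ℝ, E) F s p.proj → φ (vertField s p) = ψ (vertField s p))
    (hT : ∀ Y : Π x : M, TangentSpace 𝓘(ℝ, E) x, SmoothNear 𝓘(ℝ, E) E Y p.proj →
      φ (horField cov Y p) = ψ (horField cov Y p)) : φ = ψ := by
  ext w
  have hw := vert_connProj_add_horLift_dproj cov p w
  have hs := hV (extend F (connProj cov p w)) (smoothNear_extend _)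
  have hY := hT (extend E (dproj E p w)) (smoothNear_extend _)
  simp only [vertField, horField, extend_apply_self] at hs hY
  rw [← hw, map_add, map_add, hs, hY]

variable [FiniteDimensional ℝ E] [FiniteDimensional ℝ F]

/-- The connection `∇ ⊕ ∇^∨` on `V ⊕ V^∨`. -/
def genCov (cov : CovariantDerivative 𝓘(ℝ, E) F V) (a : Π x, Gen V x) (x : M) :
    TangentSpace 𝓘(ℝ, E) x →L[ℝ] Gen V x :=
  (cov (fun y ↦ (a y).1) x).prod (dualCov cov (fun y ↦ (a y).2) x)

variable [T2Space M] (hcov : cov.ContMDiffCovariantDerivative ∞)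
include hcov

theorem genSmoothAt_liftT (hA : GenSmoothAt 𝓘(ℝ, E) E A p.proj) :
    GenSmoothAt (totI E F) (E × F) (liftT cov A) p :=
  ⟨smoothAt_horField hcov hA.1, dualSmoothAt_projForm hA.2⟩

theorem genSmoothAt_liftV (ha : GenSmoothNear 𝓘(ℝ, E) F a p.proj) :
    GenSmoothAt (totI E F) (E × F) (liftV cov a) p :=
  ⟨smoothAt_vertField ha.fst.smoothAt, dualSmoothAt_connForm hcov ha.snd⟩

theorem mlieBracket_vertField_horField {t : Π x, V x} {Y : Π x : M, TangentSpace 𝓘(ℝ, E) x}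
    (ht : SmoothAt 𝓘(ℝ, E) F t p.proj) (hY : SmoothAt 𝓘(ℝ, E) E Y p.proj) :
    VectorField.mlieBracket (totI E F) (vertField t) (horField cov Y) p =
      -vertField (fun x ↦ cov t x (Y x)) p := by
  rw [VectorField.mlieBracket_swap_apply, mlieBracket_horField_vertField hcov hY ht]

theorem courant_liftT_liftT (hp : p.2 = 0) (hA : GenSmoothAt 𝓘(ℝ, E) E A p.proj)
    (hC : GenSmoothAt 𝓘(ℝ, E) E C p.proj) :
    courant (totI E F) (liftT cov A) (liftT cov C) p = liftT cov (courant 𝓘(ℝ, E) A C) p := by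
  have hAp := genSmoothAt_liftT hcov hA
  have hCp := genSmoothAt_liftT hcov hC
  have hdiff : MDifferentiableAt 𝓘(ℝ, E) 𝓘(ℝ, ℝ)
      (fun x ↦ (A x).2 (C x).1 - (C x).2 (A x).1) p.proj :=
    ((hA.2.apply hC.1).sub (hC.2.apply hA.1)).mdifferentiableAt (by simp)
  refine Prod.ext ?_ (eq_of_vertField_of_horField (cov := cov) (fun s hs ↦ ?_) fun Y hY ↦ ?_)
  · simp only [courant_fst, liftT_fst, mlieBracket_horField hcov hp hA.1 hC.1]
  · rw [courant_snd_apply hAp hCp (smoothAt_vertField hs.smoothAt)]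
    simp only [liftT_fst, liftT_snd_horField, liftT_snd_vertField,
      mlieBracket_horField_vertField hcov hA.1 hs.smoothAt,
      mlieBracket_horField_vertField hcov hC.1 hs.smoothAt, mvfderiv_const_apply,
      mvfderiv_comp_proj_vertField hdiff]
    ring
  · have hAY := (hA.2.apply hY.smoothAt).mdifferentiableAt (n := ∞) (by simp)
    have hCY := (hC.2.apply hY.smoothAt).mdifferentiableAt (n := ∞) (by simp)
    rw [courant_snd_apply hAp hCp (smoothAt_horField hcov hY.smoothAt), liftT_snd_horField,
      courant_snd_apply hA hC hY.smoothAt]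
    simp only [liftT_fst, liftT_snd_horField, mlieBracket_horField hcov hp hA.1 hY.smoothAt,
      mlieBracket_horField hcov hp hC.1 hY.smoothAt, mvfderiv_comp_proj_horField hdiff,
      mvfderiv_comp_proj_horField hAY, mvfderiv_comp_proj_horField hCY]

theorem courant_liftT_liftV (hp : p.2 = 0) (hA : GenSmoothAt 𝓘(ℝ, E) E A p.proj)
    (ha : GenSmoothNear 𝓘(ℝ, E) F a p.proj) :
    courant (totI E F) (liftT cov A) (liftV cov a) p =
      liftV cov (fun x ↦ genCov cov a x (A x).1) p := by
  have := FiniteDimensional.complete ℝ E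
  have hAp := genSmoothAt_liftT hcov hA
  have hap := genSmoothAt_liftV hcov ha
  refine Prod.ext ?_ (eq_of_vertField_of_horField (cov := cov) (fun s hs ↦ ?_) fun Y hY ↦ ?_)
  · simp only [courant_fst, liftT_fst, liftV_fst,
      mlieBracket_horField_vertField hcov hA.1 ha.fst.smoothAt]
    rfl
  · have has := (ha.snd.dualSmoothAt.apply hs.smoothAt).mdifferentiableAt (n := ∞) (by simp)
    rw [courant_snd_apply hAp hap (smoothAt_vertField hs.smoothAt)]
    simp only [liftT_fst, liftV_fst, liftT_snd_vertField, liftV_snd_vertField, liftV_snd_horField,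
      mlieBracket_horField_vertField hcov hA.1 hs.smoothAt,
      mlieBracket_vertField ha.fst.smoothAt hs.smoothAt, mvfderiv_const_apply,
      mvfderiv_comp_proj_horField has, genCov, ContinuousLinearMap.prod_apply, map_zero, sub_zero,
      mul_zero, add_zero]
    exact (dualCov_apply cov ha.snd.dualSmoothAt.dualMDiffAt hs.smoothAt.mdifferentiableAt _).symm
  · have hAY := (hA.2.apply hY.smoothAt).mdifferentiableAt (n := ∞) (by simp)
    rw [courant_snd_apply hAp hap (smoothAt_horField hcov hY.smoothAt)]
    simp only [liftT_fst, liftV_fst, liftT_snd_horField, liftT_snd_vertField, liftV_snd_horField,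
      mlieBracket_horField hcov hp hA.1 hY.smoothAt,
      mlieBracket_vertField_horField hcov ha.fst.smoothAt hY.smoothAt, mvfderiv_const_apply,
      mvfderiv_comp_proj_vertField hAY, map_neg, neg_zero, sub_zero, mul_zero, add_zero]

theorem courant_liftV_liftV (ha : GenSmoothNear 𝓘(ℝ, E) F a p.proj)
    (hc : GenSmoothNear 𝓘(ℝ, E) F c p.proj)
    (hac : ∀ v, pairing (genCov cov c p.proj v) (a p.proj) =
      pairing (genCov cov a p.proj v) (c p.proj)) :
    courant (totI E F) (liftV cov a) (liftV cov c) p = 0 := by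
  have hap := genSmoothAt_liftV hcov ha
  have hcp := genSmoothAt_liftV hcov hc
  have hac₁ := (ha.snd.dualSmoothAt.apply hc.fst.smoothAt).mdifferentiableAt (n := ∞) (by simp)
  have hca₁ := (hc.snd.dualSmoothAt.apply ha.fst.smoothAt).mdifferentiableAt (n := ∞) (by simp)
  have hdiff : MDifferentiableAt 𝓘(ℝ, E) 𝓘(ℝ, ℝ)
      (fun x ↦ (a x).2 (c x).1 - (c x).2 (a x).1) p.proj := hac₁.sub hca₁
  refine Prod.ext ?_ (eq_of_vertField_of_horField (cov := cov) (fun s hs ↦ ?_) fun Y hY ↦ ?_)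
  · exact mlieBracket_vertField ha.fst.smoothAt hc.fst.smoothAt
  · have has := (ha.snd.dualSmoothAt.apply hs.smoothAt).mdifferentiableAt (n := ∞) (by simp)
    have hcs := (hc.snd.dualSmoothAt.apply hs.smoothAt).mdifferentiableAt (n := ∞) (by simp)
    rw [courant_snd_apply hap hcp (smoothAt_vertField hs.smoothAt)]
    simp only [liftV_fst, liftV_snd_vertField, mlieBracket_vertField ha.fst.smoothAt hs.smoothAt,
      mlieBracket_vertField hc.fst.smoothAt hs.smoothAt, mvfderiv_comp_proj_vertField has,
      mvfderiv_comp_proj_vertField hcs, mvfderiv_comp_proj_vertField hdiff]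
    simp
  · rw [courant_snd_apply hap hcp (smoothAt_horField hcov hY.smoothAt)]
    simp only [liftV_fst, liftV_snd_vertField, liftV_snd_horField,
      mlieBracket_vertField_horField hcov ha.fst.smoothAt hY.smoothAt,
      mlieBracket_vertField_horField hcov hc.fst.smoothAt hY.smoothAt, mvfderiv_const_apply,
      mvfderiv_comp_proj_horField hdiff]
    have hsub : mvfderiv 𝓘(ℝ, E) (fun x ↦ (a x).2 (c x).1 - (c x).2 (a x).1) p.proj (Y p.proj) =
        mvfderiv 𝓘(ℝ, E) (fun x ↦ (a x).2 (c x).1) p.proj (Y p.proj) -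
          mvfderiv 𝓘(ℝ, E) (fun x ↦ (c x).2 (a x).1) p.proj (Y p.proj) :=
      DFunLike.congr_fun (mvfderiv_sub hac₁ hca₁) _
    have ha₂ := dualCov_apply cov ha.snd.dualSmoothAt.dualMDiffAt
      hc.fst.smoothAt.mdifferentiableAt (Y p.proj)
    have hc₂ := dualCov_apply cov hc.snd.dualSmoothAt.dualMDiffAt
      ha.fst.smoothAt.mdifferentiableAt (Y p.proj)
    have hacY := hac (Y p.proj)
    simp only [pairing, genCov, ContinuousLinearMap.prod_apply] at hacY
    rw [Prod.snd_zero, zero_apply, hsub, map_neg, map_neg, liftV_snd_vertField,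
      liftV_snd_vertField]
    linarith

end CourantLifts

/-! ### Adapted structures -/

section Inclusions

variable {E : Type*} [NormedAddCommGroup E] [NormedSpace ℝ E]
  {M : Type*} [TopologicalSpace M] [ChartedSpace E M]
  {V : M → Type*} [∀ x, AddCommGroup (V x)] [∀ x, Module ℝ (V x)] [∀ x, TopologicalSpace (V x)]

/-- The projection of `(V ⊕ T_M) ⊕ (V ⊕ T_M)^∨` onto `V ⊕ V^∨`. -/
def projV (x : M) : Gen (VT E V) x →ₗ[ℝ] Gen V x where
  toFun b := (b.1.1, b.2.comp (ContinuousLinearMap.inl ℝ (V x) (TangentSpace 𝓘(ℝ, E) x)))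
  map_add' a b := by ext <;> simp
  map_smul' c a := by ext <;> simp

theorem projT_inclT (x : M) (c : Gen (TangentSpace 𝓘(ℝ, E) : M → Type _) x) :
    projT (V := V) x (inclT x c) = c := by
  refine Prod.ext rfl ?_
  ext v
  simp [projT, inclT]

theorem projV_inclV (x : M) (a : Gen V x) : projV (E := E) x (inclV x a) = a := by
  refine Prod.ext rfl ?_
  ext v
  simp [projV, inclV]

theorem pairing_inclT (x : M) (b c : Gen (TangentSpace 𝓘(ℝ, E) : M → Type _) x) :
    pairing (inclT (V := V) x b) (inclT x c) = pairing b c := by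
  simp [pairing, inclT]

theorem pairing_inclV (x : M) (a b : Gen V x) :
    pairing (inclV (E := E) x a) (inclV x b) = pairing a b := by
  simp [pairing, inclV]

end Inclusions

section Adapted

variable {E : Type*} [NormedAddCommGroup E] [NormedSpace ℝ E]
  {M : Type*} [TopologicalSpace M] [ChartedSpace E M]
  [IsManifold 𝓘(ℝ, E) ∞ M]
  {F : Type*} [NormedAddCommGroup F] [NormedSpace ℝ F]
  {V : M → Type*} [TopologicalSpace (TotalSpace F V)]
  [∀ x, AddCommGroup (V x)] [∀ x, Module ℝ (V x)] [∀ x, TopologicalSpace (V x)]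
  [FiberBundle F V] [VectorBundle ℝ F V]
  {J : GACS 𝓘(ℝ, E) (F × E) (VT E V)}

/-- Up to sign, the restriction of `J` to `T_M ⊕ T_M^∨`, with values in `V ⊕ V^∨`. The sign makes it
the inverse of `baseMap J x` if `J` is adapted. -/
def baseInv (J : GACS 𝓘(ℝ, E) (F × E) (VT E V)) (x : M) :
    Gen (TangentSpace 𝓘(ℝ, E) : M → Type _) x →ₗ[ℝ] Gen V x :=
  -(projV x).comp ((J.J x : Gen (VT E V) x →ₗ[ℝ] Gen (VT E V) x).comp (inclT x))

theorem IsAdapted.inclT_baseMap (hJ : IsAdapted J) (x : M) (a : Gen V x) :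
    inclT x (baseMap J x a) = J.J x (inclV x a) := by
  obtain ⟨c, hc⟩ : J.J x (inclV x a) ∈ LinearMap.range (inclT x) := hJ x ▸ ⟨_, ⟨a, rfl⟩, rfl⟩
  change inclT x (projT x (J.J x (inclV x a))) = J.J x (inclV x a)
  rw [← hc, projT_inclT]

theorem IsAdapted.inclV_baseInv (hJ : IsAdapted J) (x : M)
    (c : Gen (TangentSpace 𝓘(ℝ, E) : M → Type _) x) :
    inclV x (baseInv J x c) = -J.J x (inclT x c) := by
  obtain ⟨_, ⟨a, rfl⟩, ha⟩ : inclT x c ∈ (LinearMap.range (inclV x)).map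
      (J.J x : Gen (VT E V) x →ₗ[ℝ] Gen (VT E V) x) := hJ x ▸ ⟨c, rfl⟩
  have hc : J.J x (inclT x c) = -inclV x a := ha ▸ J.sq x (inclV x a)
  change inclV x (-projV x (J.J x (inclT x c))) = -J.J x (inclT x c)
  rw [hc, map_neg (projV x), projV_inclV, neg_neg, neg_neg]

/-- The isomorphism `V ⊕ V^∨ ≃ T_M ⊕ T_M^∨` given by an adapted structure. -/
def IsAdapted.baseEquiv (hJ : IsAdapted J) (x : M) :
    Gen V x ≃ₗ[ℝ] Gen (TangentSpace 𝓘(ℝ, E) : M → Type _) x :=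
  .ofLinearMap (baseMap J x) (baseInv J x)
    (LinearMap.ext fun c ↦ by
      change projT x (J.J x (inclV x (baseInv J x c))) = c
      rw [hJ.inclV_baseInv, (J.J x).map_neg, J.sq, neg_neg, projT_inclT])
    (LinearMap.ext fun a ↦ by
      change -projV x (J.J x (inclT x (baseMap J x a))) = a
      rw [hJ.inclT_baseMap, J.sq, map_neg, neg_neg, projV_inclV])

theorem IsAdapted.baseMap_baseInv (hJ : IsAdapted J) (x : M)
    (c : Gen (TangentSpace 𝓘(ℝ, E) : M → Type _) x) : baseMap J x (baseInv J x c) = c :=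
  (hJ.baseEquiv x).apply_symm_apply c

theorem IsAdapted.baseInv_baseMap (hJ : IsAdapted J) (x : M) (a : Gen V x) :
    baseInv J x (baseMap J x a) = a :=
  (hJ.baseEquiv x).symm_apply_apply a

theorem IsAdapted.pairing_baseMap (hJ : IsAdapted J) (x : M) (a b : Gen V x) :
    pairing (baseMap J x a) (baseMap J x b) = pairing a b := by
  rw [← pairing_inclT (V := V), hJ.inclT_baseMap, hJ.inclT_baseMap, J.orthogonal, pairing_inclV]

end Adapted

/-! ### Lifts of structures to the total space -/

section Lifts

variable {E : Type*} [NormedAddCommGroup E] [NormedSpace ℝ E]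
  {M : Type*} [TopologicalSpace M] [ChartedSpace E M]
  {F : Type*} [NormedAddCommGroup F] [NormedSpace ℝ F]
  {V : M → Type*} [TopologicalSpace (TotalSpace F V)]
  [∀ x, AddCommGroup (V x)] [∀ x, Module ℝ (V x)] [∀ x, TopologicalSpace (V x)]
  [∀ x, IsTopologicalAddGroup (V x)] [∀ x, ContinuousSMul ℝ (V x)]
  [FiberBundle F V] [VectorBundle ℝ F V]
  {cov : CovariantDerivative 𝓘(ℝ, E) F V}

theorem splitFInv_inclT (p : TotalSpace F V)
    (A : Π x : M, Gen (TangentSpace 𝓘(ℝ, E) : M → Type _) x) :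
    splitFInv cov p (inclT p.proj (A p.proj)) = liftT cov A p := by
  refine Prod.ext ?_ ?_
  · simp [splitFInv, inclT, liftT, horField]
  · ext w
    simp [splitFInv, inclT, liftT, projForm]

theorem splitFInv_inclV (p : TotalSpace F V) (a : Π x, Gen V x) :
    splitFInv cov p (inclV p.proj (a p.proj)) = liftV cov a p := by
  refine Prod.ext ?_ ?_
  · simp [splitFInv, inclV, liftV, vertField]
  · ext w
    simp [splitFInv, inclV, liftV, connForm]

theorem liftV_sub (a c : Π x, Gen V x) (p : TotalSpace F V) :
    liftV cov (fun x ↦ a x - c x) p = liftV cov a p - liftV cov c p :=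
  Prod.ext (map_sub _ _ _) (ContinuousLinearMap.sub_comp _ _ _)

variable [ContMDiffVectorBundle ∞ F V 𝓘(ℝ, E)]

theorem splitF_splitFInv (p : TotalSpace F V) (b : Gen (VT E V) p.proj) :
    splitF cov p (splitFInv cov p b) = b := by
  refine Prod.ext (Prod.ext ?_ ?_) ?_
  · simp [splitF, splitFInv, connProj_vert, connProj_horLift]
  · simp [splitF, splitFInv, dproj_vert, dproj_horLift]
  · ext v
    · simp [splitF, splitFInv, connProj_vert, dproj_vert]
    · simp [splitF, splitFInv, connProj_horLift, dproj_horLift]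

theorem splitFInv_injective (p : TotalSpace F V) : Function.Injective (splitFInv cov p) :=
  Function.LeftInverse.injective (splitF_splitFInv p)

theorem eq_of_liftT_eq {A C : Π x : M, Gen (TangentSpace 𝓘(ℝ, E) : M → Type _) x}
    {p : TotalSpace F V} (h : liftT cov A p = liftT cov C p) : A p.proj = C p.proj := by
  rw [← splitFInv_inclT, ← splitFInv_inclT] at h
  exact Function.LeftInverse.injective (projT_inclT (V := V) p.proj) (splitFInv_injective p h)

variable [IsManifold 𝓘(ℝ, E) ∞ M]
  {𝒥 : GACS (totI E F) (E × F) (TangentSpace (totI E F) : TotalSpace F V → Type _)}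
  {J J' : GACS 𝓘(ℝ, E) (F × E) (VT E V)}

theorem IsLiftOf.apply_splitFInv (h : IsLiftOf cov 𝒥 J) (p : TotalSpace F V)
    (b : Gen (VT E V) p.proj) : 𝒥.J p (splitFInv cov p b) = splitFInv cov p (J.J p.proj b) := by
  rw [h, splitF_splitFInv]

theorem IsLiftOf.unique (h : IsLiftOf cov 𝒥 J) (h' : IsLiftOf cov 𝒥 J') : J' = J := by
  refine GACS.ext (funext fun x ↦ ContinuousLinearMap.ext fun b ↦ ?_)
  let p : TotalSpace F V := TotalSpace.mk' F x 0
  exact splitFInv_injective p ((h'.apply_splitFInv p b).symm.trans (h.apply_splitFInv p b))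

theorem IsLiftOf.apply_liftV (h : IsLiftOf cov 𝒥 J) (hJ : IsAdapted J) (a : Π x, Gen V x)
    (p : TotalSpace F V) : 𝒥.J p (liftV cov a p) = liftT cov (fun x ↦ baseMap J x (a x)) p := by
  rw [← splitFInv_inclV, h.apply_splitFInv, ← hJ.inclT_baseMap, ← splitFInv_inclT]

theorem IsLiftOf.memEigen_liftT_liftV (h : IsLiftOf cov 𝒥 J) (hJ : IsAdapted J)
    (a : Π x, Gen V x) (p : TotalSpace F V) :
    MemEigen (totI E F) (𝒥.J p) (liftT cov (fun x ↦ baseMap J x (a x)) p) (liftV cov a p) :=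
  ⟨by rw [← h.apply_liftV hJ, 𝒥.sq], h.apply_liftV hJ a p⟩

end Lifts

section SmoothVT

variable {E : Type*} [NormedAddCommGroup E] [NormedSpace ℝ E]
  {M : Type*} [TopologicalSpace M] [ChartedSpace E M]
  [IsManifold 𝓘(ℝ, E) ∞ M]
  {F : Type*} [NormedAddCommGroup F] [NormedSpace ℝ F]
  {V : M → Type*} [TopologicalSpace (TotalSpace F V)]
  [∀ x, AddCommGroup (V x)] [∀ x, Module ℝ (V x)] [∀ x, TopologicalSpace (V x)]
  [FiberBundle F V] [VectorBundle ℝ F V]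

omit [∀ x, Module ℝ (V x)] [VectorBundle ℝ F V] in
theorem smoothAt_VT_iff {s : Π x : M, VT E V x} {x : M} :
    SmoothAt 𝓘(ℝ, E) (F × E) s x ↔
      SmoothAt 𝓘(ℝ, E) F (fun y ↦ (s y).1) x ∧ SmoothAt 𝓘(ℝ, E) E (fun y ↦ (s y).2) x := by
  simp only [SmoothAt, contMDiffAt_section]
  exact contMDiffAt_prod_module_iff _

variable [FiniteDimensional ℝ E] [FiniteDimensional ℝ F] [ContMDiffVectorBundle ∞ F V 𝓘(ℝ, E)]

theorem dualSmoothAt_VT_iff {φ : Π x : M, VT E V x →L[ℝ] ℝ} {x : M} :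
    DualSmoothAt 𝓘(ℝ, E) (F × E) φ x ↔
      DualSmoothAt 𝓘(ℝ, E) F
        (fun y ↦ (φ y).comp (ContinuousLinearMap.inl ℝ (V y) (TangentSpace 𝓘(ℝ, E) y))) x ∧
      DualSmoothAt 𝓘(ℝ, E) E
        (fun y ↦ (φ y).comp (ContinuousLinearMap.inr ℝ (V y) (TangentSpace 𝓘(ℝ, E) y))) x := by
  constructor
  · intro h
    constructor
    · refine dualSmoothAt_of_forall fun s hs ↦ ?_
      exact h.apply (s := fun y ↦ (s y, 0)) (smoothAt_VT_iff.2 ⟨hs.smoothAt, smoothAt_zero x⟩)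
    · refine dualSmoothAt_of_forall fun Y hY ↦ ?_
      refine h.apply (s := fun y ↦ (0, Y y)) (smoothAt_VT_iff.2 ⟨?_, hY.smoothAt⟩)
      exact (contMDiff_zeroSection ℝ V).contMDiffAt
  · rintro ⟨hV, hT⟩
    refine dualSmoothAt_of_forall fun s hs ↦ ?_
    have hs' := smoothAt_VT_iff.1 hs.smoothAt
    refine ((hV.apply hs'.1).add (hT.apply hs'.2)).congr_of_eventuallyEq (.of_forall fun y ↦ ?_)
    simp [← map_add]

theorem genSmoothOn_inclV {U : Set M} (hU : IsOpen U) {a : Π x, Gen V x}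
    (ha : GenSmoothOn 𝓘(ℝ, E) F U a) :
    GenSmoothOn 𝓘(ℝ, E) (F × E) U (fun x ↦ inclV (E := E) x (a x)) := by
  refine ⟨(smoothOn_iff hU).2 fun x hx ↦ smoothAt_VT_iff.2
    ⟨(smoothOn_iff hU).1 ha.1 x hx, smoothAt_zero x⟩, (dualSmoothOn_iff hU).2 fun x hx ↦ ?_⟩
  refine dualSmoothAt_of_forall fun s hs ↦ ?_
  exact ((dualSmoothOn_iff hU).1 ha.2 x hx).apply (smoothAt_VT_iff.1 hs.smoothAt).1

theorem genSmoothOn_inclT {U : Set M} (hU : IsOpen U)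
    {a : Π x, Gen (TangentSpace 𝓘(ℝ, E) : M → Type _) x} (ha : GenSmoothOn 𝓘(ℝ, E) E U a) :
    GenSmoothOn 𝓘(ℝ, E) (F × E) U (fun x ↦ inclT (V := V) x (a x)) := by
  refine ⟨(smoothOn_iff hU).2 fun x hx ↦ smoothAt_VT_iff.2
    ⟨(contMDiff_zeroSection ℝ V).contMDiffAt, (smoothOn_iff hU).1 ha.1 x hx⟩,
    (dualSmoothOn_iff hU).2 fun x hx ↦ ?_⟩
  refine dualSmoothAt_of_forall fun s hs ↦ ?_
  exact ((dualSmoothOn_iff hU).1 ha.2 x hx).apply (smoothAt_VT_iff.1 hs.smoothAt).2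

theorem genSmoothOn_projT {U : Set M} (hU : IsOpen U) {b : Π x, Gen (VT E V) x}
    (hb : GenSmoothOn 𝓘(ℝ, E) (F × E) U b) :
    GenSmoothOn 𝓘(ℝ, E) E U (fun x ↦ projT x (b x)) :=
  ⟨(smoothOn_iff hU).2 fun x hx ↦ (smoothAt_VT_iff.1 ((smoothOn_iff hU).1 hb.1 x hx)).2,
    (dualSmoothOn_iff hU).2 fun x hx ↦
      (dualSmoothAt_VT_iff.1 ((dualSmoothOn_iff hU).1 hb.2 x hx)).2⟩

theorem genSmoothOn_neg_projV {U : Set M} (hU : IsOpen U) {b : Π x, Gen (VT E V) x}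
    (hb : GenSmoothOn 𝓘(ℝ, E) (F × E) U b) :
    GenSmoothOn 𝓘(ℝ, E) F U (fun x ↦ -projV x (b x)) := by
  refine ⟨(smoothOn_iff hU).2 fun x hx ↦ ?_, (dualSmoothOn_iff hU).2 fun x hx ↦ ?_⟩
  · exact ContMDiffAt.neg_section (smoothAt_VT_iff.1 ((smoothOn_iff hU).1 hb.1 x hx)).1
  · refine dualSmoothAt_of_forall fun s hs ↦ ?_
    exact ((dualSmoothAt_VT_iff.1 ((dualSmoothOn_iff hU).1 hb.2 x hx)).1.apply hs.smoothAt).neg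

theorem genSmoothOn_baseMap (J : GACS 𝓘(ℝ, E) (F × E) (VT E V)) {U : Set M} (hU : IsOpen U)
    {a : Π x, Gen V x} (ha : GenSmoothOn 𝓘(ℝ, E) F U a) :
    GenSmoothOn 𝓘(ℝ, E) E U (fun x ↦ baseMap J x (a x)) :=
  genSmoothOn_projT hU (J.smooth U _ hU (genSmoothOn_inclV hU ha))

theorem genSmoothOn_baseInv (J : GACS 𝓘(ℝ, E) (F × E) (VT E V)) {U : Set M} (hU : IsOpen U)
    {a : Π x, Gen (TangentSpace 𝓘(ℝ, E) : M → Type _) x} (ha : GenSmoothOn 𝓘(ℝ, E) E U a) :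
    GenSmoothOn 𝓘(ℝ, E) F U (fun x ↦ baseInv J x (a x)) :=
  genSmoothOn_neg_projV hU (J.smooth U _ hU (genSmoothOn_inclT hU ha))

variable [T2Space M] [∀ x, IsTopologicalAddGroup (V x)] [∀ x, ContinuousSMul ℝ (V x)]
  {cov : CovariantDerivative 𝓘(ℝ, E) F V} {J : GACS 𝓘(ℝ, E) (F × E) (VT E V)}
  {𝒥 : GACS (totI E F) (E × F) (TangentSpace (totI E F) : TotalSpace F V → Type _)}

/-- Both `a` and `c` lift to sections `liftT (J a) + i liftV a` of the `+i`-eigenbundle of `𝒥`; the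
formula is the imaginary part of the statement that their bracket is again such a section. -/
theorem IsLiftOf.courant_baseMap (hcov : cov.ContMDiffCovariantDerivative ∞)
    (h : IsLiftOf cov 𝒥 J) (hJ : IsAdapted J) (hint : 𝒥.IsIntegrable) {U : Set M} (hU : IsOpen U)
    {a c : Π x, Gen V x} (ha : GenSmoothOn 𝓘(ℝ, E) F U a) (hc : GenSmoothOn 𝓘(ℝ, E) F U c)
    {x : M} (hx : x ∈ U)
    (hac : ∀ v, pairing (genCov cov c x v) (a x) = pairing (genCov cov a x v) (c x)) :
    courant 𝓘(ℝ, E) (fun y ↦ baseMap J y (a y)) (fun y ↦ baseMap J y (c y)) x =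
      baseMap J x
        (genCov cov c x (baseMap J x (a x)).1 - genCov cov a x (baseMap J x (c x)).1) := by
  let p : TotalSpace F V := TotalSpace.mk' F x 0
  have hU' : IsOpen {q : TotalSpace F V | q.proj ∈ U} :=
    hU.preimage (FiberBundle.continuous_proj F V)
  have smooth_liftT {a : Π x, Gen V x} (ha : GenSmoothOn 𝓘(ℝ, E) F U a) :=
    (genSmoothOn_iff hU').2 fun q hq ↦ genSmoothAt_liftT (p := q) hcov
      ((genSmoothOn_baseMap J hU ha).genSmoothNear hU hq).genSmoothAt
  have smooth_liftV {a : Π x, Gen V x} (ha : GenSmoothOn 𝓘(ℝ, E) F U a) :=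
    (genSmoothOn_iff hU').2 fun q hq ↦ genSmoothAt_liftV (p := q) hcov (ha.genSmoothNear hU hq)
  obtain ⟨-, him⟩ := hint _ _ _ _ _ hU' (smooth_liftT ha) (smooth_liftV ha) (smooth_liftT hc)
    (smooth_liftV hc) (fun q _ ↦ h.memEigen_liftT_liftV hJ a q)
    (fun q _ ↦ h.memEigen_liftT_liftV hJ c q) p hx
  have hBa := ((genSmoothOn_baseMap J hU ha).genSmoothNear hU hx).genSmoothAt
  have hBc := ((genSmoothOn_baseMap J hU hc).genSmoothNear hU hx).genSmoothAt
  have ha' := ha.genSmoothNear hU hx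
  have hc' := hc.genSmoothNear hU hx
  rw [courant_swap _ (liftV cov a), courant_liftT_liftV (p := p) hcov rfl hBa hc',
    courant_liftT_liftV (p := p) hcov rfl hBc ha', courant_liftV_liftV (p := p) hcov ha' hc' hac,
    courant_liftT_liftT (p := p) hcov rfl hBa hBc, sub_zero, ← sub_eq_add_neg, ← liftV_sub,
    h.apply_liftV hJ] at him
  exact (eq_of_liftT_eq (p := p) him).symm

end SmoothVT

/-! ### Maximally isotropic subspaces -/

section Isotropic

variable {W : Type*} [AddCommGroup W] [Module ℝ W] [TopologicalSpace W]
  [IsTopologicalAddGroup W] [ContinuousSMul ℝ W]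

theorem maximal_isIsotropic_range_inl :
    Maximal IsIsotropic (LinearMap.range (LinearMap.inl ℝ W (W →L[ℝ] ℝ))) := by
  rw [LinearMap.range_inl]
  refine ⟨fun a (ha : a.2 = 0) b (hb : b.2 = 0) ↦ by simp [pairing, ha, hb], fun S hS hle a ha ↦ ?_⟩
  ext w
  simpa [pairing] using hS a ha (w, 0) (hle (LinearMap.mem_ker.2 rfl))

theorem maximal_isIsotropic_range_inr [SeparatingDual ℝ W] :
    Maximal IsIsotropic (LinearMap.range (LinearMap.inr ℝ W (W →L[ℝ] ℝ))) := by
  rw [LinearMap.range_inr]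
  refine ⟨fun a (ha : a.1 = 0) b (hb : b.1 = 0) ↦ by simp [pairing, ha, hb], fun S hS hle a ha ↦ ?_⟩
  refine SeparatingDual.eq_zero_of_forall_dual_eq_zero (R := ℝ) fun l ↦ ?_
  simpa [pairing] using hS a ha (0, l) (hle (LinearMap.mem_ker.2 rfl))

theorem maximal_isIsotropic_map {W' : Type*} [AddCommGroup W'] [Module ℝ W'] [TopologicalSpace W']
    [IsTopologicalAddGroup W'] [ContinuousSMul ℝ W']
    (φ : (W × (W →L[ℝ] ℝ)) ≃ₗ[ℝ] (W' × (W' →L[ℝ] ℝ)))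
    (hφ : ∀ a b, pairing (φ a) (φ b) = pairing a b) {S : Submodule ℝ (W × (W →L[ℝ] ℝ))}
    (hS : Maximal IsIsotropic S) : Maximal IsIsotropic (S.map φ.toLinearMap) := by
  constructor
  · rintro _ ⟨a, ha, rfl⟩ _ ⟨b, hb, rfl⟩
    exact (hφ a b).trans (hS.prop a ha b hb)
  · intro T hT hle c hc
    have hcomap : IsIsotropic (T.comap φ.toLinearMap) := fun a ha b hb ↦
      (hφ a b).symm.trans (hT _ ha _ hb)
    refine ⟨φ.symm c, hS.le_of_ge hcomap (Submodule.map_le_iff_le_comap.1 hle) ?_,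
      φ.apply_symm_apply c⟩
    simpa using hc

end Isotropic

theorem separatingDual_fiber {B : Type*} [TopologicalSpace B] (F : Type*) [NormedAddCommGroup F]
    [NormedSpace ℝ F] {W : B → Type*} [TopologicalSpace (TotalSpace F W)]
    [∀ x, AddCommGroup (W x)] [∀ x, Module ℝ (W x)] [∀ x, TopologicalSpace (W x)]
    [FiberBundle F W] [VectorBundle ℝ F W] (x : B) : SeparatingDual ℝ (W x) where
  exists_ne_zero' w hw := by
    let e := (trivializationAt F W x).continuousLinearEquivAt ℝ x
      (mem_baseSet_trivializationAt F W x)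
    obtain ⟨l, hl⟩ := SeparatingDual.exists_ne_zero (R := ℝ) (e.map_ne_zero_iff.2 hw)
    exact ⟨l.comp e.toContinuousLinearMap, hl⟩

/-! ### Subbundles parametrized by vector bundles -/

section Embedding

variable {E : Type*} [NormedAddCommGroup E] [NormedSpace ℝ E]
  {H : Type*} [TopologicalSpace H] (I : ModelWithCorners ℝ E H)
  {B : Type*} [TopologicalSpace B] [ChartedSpace H B] [IsManifold I 2 B]
  (F : Type*) [NormedAddCommGroup F] [NormedSpace ℝ F]
  (W : B → Type*) [TopologicalSpace (TotalSpace F W)]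
  [∀ x, AddCommGroup (W x)] [∀ x, Module ℝ (W x)] [∀ x, TopologicalSpace (W x)]
  [FiberBundle F W]

/-- A smooth bundle map `W → T ⊕ T^∨` together with a smooth left inverse, presenting its image as
a subbundle isomorphic to `W`. -/
structure SplitEmbedding where
  toMap : Π x : B, W x →ₗ[ℝ] Gen (TangentSpace I : B → Type _) x
  retract : Π x : B, Gen (TangentSpace I : B → Type _) x →ₗ[ℝ] W x
  retract_toMap : ∀ x w, retract x (toMap x w) = w
  genSmoothOn_toMap : ∀ (U : Set B) (s : Π x, W x), IsOpen U → SmoothOn I F U s →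
    GenSmoothOn I E U (fun x ↦ toMap x (s x))
  smoothOn_retract : ∀ (U : Set B) (a : Π x : B, Gen (TangentSpace I : B → Type _) x), IsOpen U →
    GenSmoothOn I E U a → SmoothOn I F U (fun x ↦ retract x (a x))

namespace SplitEmbedding

variable {I F W}

/-- The image of a split embedding, as a family of subspaces of the fibres of `T ⊕ T^∨`. -/
def range (φ : SplitEmbedding I F W) (x : B) : Submodule ℝ (Gen (TangentSpace I : B → Type _) x) :=
  LinearMap.range (φ.toMap x)

theorem toMap_retract (φ : SplitEmbedding I F W) {x : B}
    {c : Gen (TangentSpace I : B → Type _) x} (hc : c ∈ φ.range x) :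
    φ.toMap x (φ.retract x c) = c := by
  obtain ⟨w, rfl⟩ := hc
  rw [φ.retract_toMap]

section Subbundle

variable [FiniteDimensional ℝ F] [VectorBundle ℝ F W] [ContMDiffVectorBundle ∞ F W I]

theorem isSubbundle_range (φ : SplitEmbedding I F W) : IsSubbundle I φ.range := by
  intro x₀
  let e := trivializationAt F W x₀
  let b := Module.finBasis ℝ F
  refine ⟨e.baseSet, _, fun i x ↦ φ.toMap x (e.symm x (b i)), e.open_baseSet,
    mem_baseSet_trivializationAt F W x₀, fun i ↦ φ.genSmoothOn_toMap _ _ e.open_baseSet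
      ((smoothOn_iff e.open_baseSet).2 fun x hx ↦ smoothAt_symm e hx (b i)), fun x hx ↦ ?_⟩
  let Θ : F ≃ₗ[ℝ] W x := (e.continuousLinearEquivAt ℝ x hx).symm.toLinearEquiv
  have hframe (i) : φ.toMap x (e.symm x (b i)) = φ.toMap x ((b.map Θ) i) := by
    rw [Module.Basis.map_apply]
    exact congrArg (φ.toMap x) ((e.symmL_apply (R := ℝ) hx (b i)).symm.trans
      (congrFun (e.symm_continuousLinearEquivAt_eq hx) (b i)).symm)
  simp only [hframe]
  refine ⟨(b.map Θ).linearIndependent.map' _ (LinearMap.ker_eq_bot.2 <|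
    Function.LeftInverse.injective (φ.retract_toMap x)), ?_⟩
  rw [range, LinearMap.range_eq_map, ← (b.map Θ).span_eq, Submodule.map_span, ← Set.range_comp]
  rfl

end Subbundle

section Connection

variable [FiniteDimensional ℝ E]
  [∀ x, IsTopologicalAddGroup (W x)] [∀ x, ContinuousSMul ℝ (W x)]
  (φ : SplitEmbedding I F W) (cov : CovariantDerivative I F W)
  (hcov : ∀ (U : Set B) (s : Π x, W x) (X : Π x : B, TangentSpace I x), IsOpen U →
    SmoothOn I F U s → SmoothOn I E U X → SmoothOn I F U (fun x ↦ cov s x (X x)))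

/-- The transport to `φ.range` of a connection on `W`. -/
def connection : SubbundleConnection I φ.range :=
  have (x : B) : FiniteDimensional ℝ (TangentSpace I x) := inferInstanceAs (FiniteDimensional ℝ E)
  have (x : B) : T2Space (TangentSpace I x) := inferInstanceAs (T2Space E)
  { toFun a x := LinearMap.toContinuousLinearMap
      (φ.toMap x ∘ₗ (cov (fun y ↦ φ.retract y (a y)) x).toLinearMap)
    congr U a a' hU ha ha' h x hx := by
      have hcongr := cov_congr (cov := cov)
        ((smoothOn_iff hU).1 (φ.smoothOn_retract U a hU ha.1) x hx)
        ((smoothOn_iff hU).1 (φ.smoothOn_retract U a' hU ha'.1) x hx)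
        (Filter.mem_of_superset (hU.mem_nhds hx) fun y hy ↦ congrArg (φ.retract y) (h y hy))
      rw [hcongr]
    isSectionOn U a X hU ha hX :=
      ⟨φ.genSmoothOn_toMap U _ hU (hcov U _ X hU (φ.smoothOn_retract U a hU ha.1) hX),
        fun x _ ↦ ⟨_, rfl⟩⟩
    add U a a' hU ha ha' x hx := by
      have hadd := cov.isCovariantDerivativeOnUniv.add
        ((smoothOn_iff hU).1 (φ.smoothOn_retract U a hU ha.1) x hx).mdifferentiableAt
        ((smoothOn_iff hU).1 (φ.smoothOn_retract U a' hU ha'.1) x hx).mdifferentiableAt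
      simp only [map_add]
      ext1 v
      refine (congrArg (fun l : TangentSpace I x →L[ℝ] W x ↦ φ.toMap x (l v)) hadd).trans ?_
      exact map_add (φ.toMap x) _ _
    leibniz U f a hU hf ha x hx v := by
      have hleibniz := cov.isCovariantDerivativeOnUniv.leibniz
        ((smoothOn_iff hU).1 (φ.smoothOn_retract U a hU ha.1) x hx).mdifferentiableAt
        ((hf.contMDiffAt (hU.mem_nhds hx)).mdifferentiableAt (by simp))
      simp only [map_smul]
      refine (congrArg (fun l : TangentSpace I x →L[ℝ] W x ↦ φ.toMap x (l v)) hleibniz).trans ?_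
      simp [φ.toMap_retract (ha.2 x hx)] }

theorem connection_apply (a : Π x : B, Gen (TangentSpace I : B → Type _) x) {x : B}
    (v : TangentSpace I x) : (φ.connection cov hcov).toFun a x v =
      φ.toMap x (cov (fun y ↦ φ.retract y (a y)) x v) :=
  rfl

theorem connection_isFlat (hflat : ∀ (U : Set B) (X Y : Π x : B, TangentSpace I x) (s : Π x, W x),
      IsOpen U → SmoothOn I E U X → SmoothOn I E U Y → SmoothOn I F U s → ∀ x ∈ U,
        cov (fun y ↦ cov s y (Y y)) x (X x) - cov (fun y ↦ cov s y (X y)) x (Y x)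
          - cov s x (VectorField.mlieBracket I X Y x) = 0) :
    (φ.connection cov hcov).IsFlat := by
  intro U X Y a hU hX hY ha x hx
  simp only [connection_apply, φ.retract_toMap, ← map_sub]
  rw [hflat U X Y _ hU hX hY (φ.smoothOn_retract U a hU ha.1) x hx, map_zero]

theorem connection_toMap (s : Π x, W x) {x : B} (v : TangentSpace I x) :
    (φ.connection cov hcov).toFun (fun y ↦ φ.toMap y (s y)) x v = φ.toMap x (cov s x v) := by
  simp only [connection_apply, φ.retract_toMap]

end Connection

end SplitEmbedding

end Embedding

/-! ### The Dirac structures of an adapted structure -/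

section Adapted

variable {E : Type*} [NormedAddCommGroup E] [NormedSpace ℝ E]
  {M : Type*} [TopologicalSpace M] [ChartedSpace E M] [IsManifold 𝓘(ℝ, E) ∞ M]
  {F : Type*} [NormedAddCommGroup F] [NormedSpace ℝ F]
  {V : M → Type*} [TopologicalSpace (TotalSpace F V)]
  [∀ x, AddCommGroup (V x)] [∀ x, Module ℝ (V x)] [∀ x, TopologicalSpace (V x)]
  [FiberBundle F V] [VectorBundle ℝ F V]
  {J : GACS 𝓘(ℝ, E) (F × E) (VT E V)}

theorem diracV_eq_map (J : GACS 𝓘(ℝ, E) (F × E) (VT E V)) (x : M) :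
    diracV J x = (LinearMap.range (LinearMap.inl ℝ (V x) (V x →L[ℝ] ℝ))).map (baseMap J x) :=
  LinearMap.range_comp _ _

theorem diracVDual_eq_map (J : GACS 𝓘(ℝ, E) (F × E) (VT E V)) (x : M) :
    diracVDual J x = (LinearMap.range (LinearMap.inr ℝ (V x) (V x →L[ℝ] ℝ))).map (baseMap J x) :=
  LinearMap.range_comp _ _

theorem IsAdapted.isCompl (hJ : IsAdapted J) (x : M) : IsCompl (diracV J x) (diracVDual J x) := by
  rw [diracV_eq_map, diracVDual_eq_map]
  exact LinearMap.isCompl_range_inl_inr.map (Submodule.orderIsoMapComap (hJ.baseEquiv x))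

variable [FiniteDimensional ℝ E] [FiniteDimensional ℝ F] [∀ x, IsTopologicalAddGroup (V x)]
  [∀ x, ContinuousSMul ℝ (V x)] [ContMDiffVectorBundle ∞ F V 𝓘(ℝ, E)]
  {cov : CovariantDerivative 𝓘(ℝ, E) F V}
  {𝒥 : GACS (totI E F) (E × F) (TangentSpace (totI E F) : TotalSpace F V → Type _)}

/-- The embedding `J : V → T_M ⊕ T_M^∨`, with image `diracV J`. -/
def IsAdapted.embeddingV (hJ : IsAdapted J) : SplitEmbedding 𝓘(ℝ, E) F V where
  toMap x := baseMap J x ∘ₗ LinearMap.inl ℝ (V x) (V x →L[ℝ] ℝ)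
  retract x := LinearMap.fst ℝ (V x) (V x →L[ℝ] ℝ) ∘ₗ baseInv J x
  retract_toMap x w := congrArg Prod.fst (hJ.baseInv_baseMap x (w, 0))
  genSmoothOn_toMap _ _ hU hs := genSmoothOn_baseMap J hU ⟨hs, (dualSmoothOn_iff hU).2 fun _ _ ↦
    dualSmoothAt_of_forall fun _ _ ↦ contMDiffAt_const⟩
  smoothOn_retract _ _ hU ha := (genSmoothOn_baseInv J hU ha).1

/-- The embedding `J : V^∨ → T_M ⊕ T_M^∨`, with image `diracVDual J`. -/
def IsAdapted.embeddingVDual (hJ : IsAdapted J) :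
    SplitEmbedding 𝓘(ℝ, E) (F →L[ℝ] ℝ) (fun x ↦ V x →L[ℝ] Bundle.Trivial M ℝ x) where
  toMap x := baseMap J x ∘ₗ LinearMap.inr ℝ (V x) (V x →L[ℝ] ℝ)
  retract x := LinearMap.snd ℝ (V x) (V x →L[ℝ] ℝ) ∘ₗ baseInv J x
  retract_toMap x l := congrArg Prod.snd (hJ.baseInv_baseMap x (0, l))
  genSmoothOn_toMap _ _ hU hξ :=
    genSmoothOn_baseMap J hU ⟨(contMDiff_zeroSection ℝ V).contMDiffOn, hξ⟩
  smoothOn_retract _ _ hU ha := (genSmoothOn_baseInv J hU ha).2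

theorem IsLiftOf.isDirac_map [T2Space M] (hcov : cov.ContMDiffCovariantDerivative ∞)
    (h : IsLiftOf cov 𝒥 J) (hJ : IsAdapted J) (hint : 𝒥.IsIntegrable)
    {K : Π x, Submodule ℝ (Gen V x)} (hmax : ∀ x, Maximal IsIsotropic (K x))
    (hpar : ∀ U a, IsOpen U → GenSmoothOn 𝓘(ℝ, E) F U a → (∀ x ∈ U, a x ∈ K x) →
      ∀ x ∈ U, ∀ v, genCov cov a x v ∈ K x)
    (hsub : IsSubbundle 𝓘(ℝ, E) fun x ↦ (K x).map (baseMap J x)) :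
    IsDirac 𝓘(ℝ, E) fun x ↦ (K x).map (baseMap J x) := by
  refine ⟨⟨hsub, fun x ↦ maximal_isIsotropic_map (hJ.baseEquiv x) (hJ.pairing_baseMap x)
    (hmax x)⟩, fun U A C hU hA hC x hx ↦ ?_⟩
  have baseInv_mem {A} (hA : IsSectionOn 𝓘(ℝ, E) (fun x ↦ (K x).map (baseMap J x)) U A)
      (y) (hy : y ∈ U) : baseInv J y (A y) ∈ K y := by
    obtain ⟨a, ha, haA⟩ := hA.2 y hy
    rwa [← haA, hJ.baseInv_baseMap]
  have hparA := hpar U _ hU (genSmoothOn_baseInv J hU hA.1) (baseInv_mem hA) x hx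
  have hparC := hpar U _ hU (genSmoothOn_baseInv J hU hC.1) (baseInv_mem hC) x hx
  have hcourant := h.courant_baseMap hcov hJ hint hU (genSmoothOn_baseInv J hU hA.1)
    (genSmoothOn_baseInv J hU hC.1) hx fun v ↦
      ((hmax x).prop _ (hparC v) _ (baseInv_mem hA x hx)).trans
        ((hmax x).prop _ (hparA v) _ (baseInv_mem hC x hx)).symm
  simp only [hJ.baseMap_baseInv] at hcourant
  exact ⟨_, sub_mem (hparC _) (hparA _), hcourant.symm⟩

theorem IsLiftOf.isDirac_diracV [T2Space M] (hcov : cov.ContMDiffCovariantDerivative ∞)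
    (h : IsLiftOf cov 𝒥 J) (hJ : IsAdapted J) (hint : 𝒥.IsIntegrable) :
    IsDirac 𝓘(ℝ, E) (diracV J) := by
  rw [funext (diracV_eq_map J)]
  refine h.isDirac_map hcov hJ hint (fun x ↦ maximal_isIsotropic_range_inl)
    (fun U a hU ha haK x hx v ↦ ?_) (funext (diracV_eq_map J) ▸ hJ.embeddingV.isSubbundle_range)
  simp only [LinearMap.range_inl, LinearMap.mem_ker, LinearMap.snd_apply] at haK ⊢
  have hzero : dualCov cov (fun y ↦ (a y).2) x = dualCov cov 0 x :=
    dualCov_congr ((dualSmoothOn_iff hU).1 ha.2 x hx)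
      (dualSmoothAt_of_forall fun _ _ ↦ contMDiffAt_const)
      (Filter.mem_of_superset (hU.mem_nhds hx) haK)
  exact congrArg (fun l ↦ l v) (hzero.trans (congrFun (dualConnection cov).zero x))

theorem IsLiftOf.isDirac_diracVDual [T2Space M] (hcov : cov.ContMDiffCovariantDerivative ∞)
    (h : IsLiftOf cov 𝒥 J) (hJ : IsAdapted J) (hint : 𝒥.IsIntegrable) :
    IsDirac 𝓘(ℝ, E) (diracVDual J) := by
  have := separatingDual_fiber F (W := V)
  rw [funext (diracVDual_eq_map J)]
  refine h.isDirac_map hcov hJ hint (fun x ↦ maximal_isIsotropic_range_inr)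
    (fun U a hU ha haK x hx v ↦ ?_)
    (funext (diracVDual_eq_map J) ▸ hJ.embeddingVDual.isSubbundle_range)
  simp only [LinearMap.range_inr, LinearMap.mem_ker, LinearMap.fst_apply] at haK ⊢
  have hzero : cov (fun y ↦ (a y).1) x = cov 0 x :=
    cov_congr ((smoothOn_iff hU).1 ha.1 x hx) (contMDiff_zeroSection ℝ V x)
      (Filter.mem_of_superset (hU.mem_nhds hx) haK)
  exact congrArg (fun l ↦ l v) (hzero.trans (congrFun cov.zero x))

/-! ### The connections on the Dirac structures -/

theorem IsAdapted.exists_connection_diracV [T2Space M] (hJ : IsAdapted J)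
    (hcov : cov.ContMDiffCovariantDerivative ∞) :
    ∃ D : SubbundleConnection 𝓘(ℝ, E) (diracV J), (IsFlat cov → D.IsFlat) ∧
      ∀ (s : Π x, V x) (x : M) (v : TangentSpace 𝓘(ℝ, E) x),
        D.toFun (fun y ↦ baseMap J y (s y, 0)) x v = baseMap J x (cov s x v, 0) := by
  let D := hJ.embeddingV.connection cov fun U s X hU hs hX ↦ (smoothOn_iff hU).2 fun x hx ↦
    cov_smoothAt hcov (hs.smoothNear hU hx) ((smoothOn_iff hU).1 hX x hx)
  exact ⟨D, hJ.embeddingV.connection_isFlat cov _, fun s _ ↦ hJ.embeddingV.connection_toMap cov _ s⟩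

theorem IsAdapted.exists_connection_diracVDual [T2Space M] (hJ : IsAdapted J)
    (hcov : cov.ContMDiffCovariantDerivative ∞) :
    ∃ D : SubbundleConnection 𝓘(ℝ, E) (diracVDual J), (IsFlat cov → D.IsFlat) ∧
      ∀ (ξ : Π x, V x →L[ℝ] ℝ) (x : M) (v : TangentSpace 𝓘(ℝ, E) x),
        D.toFun (fun y ↦ baseMap J y (0, ξ y)) x v = baseMap J x (0, dualCov cov ξ x v) := by
  let D := hJ.embeddingVDual.connection (dualConnection cov) fun U ξ X hU hξ hX ↦
    (dualSmoothOn_iff hU).2 fun x hx ↦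
      dualCov_smoothAt hcov (hξ.smoothNear hU hx) ((smoothOn_iff hU).1 hX x hx)
  exact ⟨D, fun hflat ↦ hJ.embeddingVDual.connection_isFlat (dualConnection cov) _
      fun U X Y ξ hU hX hY hξ x hx ↦ dualCov_flat hcov hflat (hξ.smoothNear hU hx)
        (hX.smoothNear hU hx) (hY.smoothNear hU hx),
    fun ξ _ ↦ hJ.embeddingVDual.connection_toMap (dualConnection cov) _ ξ⟩

end Adapted

end GenGeom

end

theorem mainTheorem6_general
    {E : Type*} [NormedAddCommGroup E] [NormedSpace ℝ E] [FiniteDimensional ℝ E]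
    {M : Type*} [TopologicalSpace M] [T2Space M] [ChartedSpace E M]
    [IsManifold 𝓘(ℝ, E) ∞ M]
    {F : Type*} [NormedAddCommGroup F] [NormedSpace ℝ F] [FiniteDimensional ℝ F]
    {V : M → Type*} [TopologicalSpace (TotalSpace F V)]
    [∀ x, AddCommGroup (V x)] [∀ x, Module ℝ (V x)] [∀ x, TopologicalSpace (V x)]
    [∀ x, IsTopologicalAddGroup (V x)] [∀ x, ContinuousSMul ℝ (V x)]
    [FiberBundle F V] [VectorBundle ℝ F V] [ContMDiffVectorBundle ∞ F V 𝓘(ℝ, E)]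
    (cov : CovariantDerivative 𝓘(ℝ, E) F V) (hcov : cov.ContMDiffCovariantDerivative ∞)
    (𝒥 : GenGeom.GACS (𝓘(ℝ, E).prod 𝓘(ℝ, F)) (E × F)
      (TangentSpace (𝓘(ℝ, E).prod 𝓘(ℝ, F)) : TotalSpace F V → Type _))
    (hsf : ∃ J, GenGeom.IsLiftOf cov 𝒥 J ∧ GenGeom.IsAdapted J) (hint : 𝒥.IsIntegrable) :
    ∃ J : GenGeom.GACS 𝓘(ℝ, E) (F × E) (GenGeom.VT E V),
      (GenGeom.IsLiftOf cov 𝒥 J ∧ ∀ J', GenGeom.IsLiftOf cov 𝒥 J' → J' = J) ∧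
      GenGeom.IsAdapted J ∧
      GenGeom.IsDirac 𝓘(ℝ, E) (GenGeom.diracV J) ∧
      GenGeom.IsDirac 𝓘(ℝ, E) (GenGeom.diracVDual J) ∧
      (∀ x, IsCompl (GenGeom.diracV J x) (GenGeom.diracVDual J x)) ∧
      (∃ D : GenGeom.SubbundleConnection 𝓘(ℝ, E) (GenGeom.diracV J),
        (GenGeom.IsFlat cov → D.IsFlat) ∧
        ∀ (U : Set M) (s : Π x, V x), IsOpen U → GenGeom.SmoothOn 𝓘(ℝ, E) F U s →
          ∀ x ∈ U, ∀ v : TangentSpace 𝓘(ℝ, E) x,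
            D.toFun (fun y ↦ GenGeom.baseMap J y (s y, 0)) x v =
              GenGeom.baseMap J x (cov s x v, 0)) ∧
      (∃ D : GenGeom.SubbundleConnection 𝓘(ℝ, E) (GenGeom.diracVDual J),
        (GenGeom.IsFlat cov → D.IsFlat) ∧
        ∀ (U : Set M) (ξ : Π x, V x →L[ℝ] ℝ), IsOpen U → GenGeom.DualSmoothOn 𝓘(ℝ, E) F U ξ →
          ∀ x ∈ U, ∀ v : TangentSpace 𝓘(ℝ, E) x,
            D.toFun (fun y ↦ GenGeom.baseMap J y (0, ξ y)) x v =
              GenGeom.baseMap J x (0, GenGeom.dualCov cov ξ x v)) := by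
  obtain ⟨J, hlift, hJ⟩ := hsf
  obtain ⟨D, hD, hcovD⟩ := hJ.exists_connection_diracV hcov
  obtain ⟨D', hD', hcovD'⟩ := hJ.exists_connection_diracVDual hcov
  exact ⟨J, ⟨hlift, fun _ h ↦ hlift.unique h⟩, hJ, hlift.isDirac_diracV hcov hJ hint,
    hlift.isDirac_diracVDual hcov hJ hint, hJ.isCompl,
    ⟨D, hD, fun _ s _ _ x _ ↦ hcovD s x⟩, ⟨D', hD', fun _ ξ _ _ x _ ↦ hcovD' ξ x⟩⟩

theorem mainTheorem6
    {E : Type*} [NormedAddCommGroup E] [NormedSpace ℝ E] [FiniteDimensional ℝ E]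
    {M : Type*} [TopologicalSpace M] [T2Space M] [SecondCountableTopology M] [ChartedSpace E M]
    [IsManifold 𝓘(ℝ, E) ∞ M]
    {F : Type*} [NormedAddCommGroup F] [NormedSpace ℝ F] [FiniteDimensional ℝ F]
    {V : M → Type*} [TopologicalSpace (TotalSpace F V)]
    [∀ x, AddCommGroup (V x)] [∀ x, Module ℝ (V x)] [∀ x, TopologicalSpace (V x)]
    [∀ x, IsTopologicalAddGroup (V x)] [∀ x, ContinuousSMul ℝ (V x)]
    [FiberBundle F V] [VectorBundle ℝ F V] [ContMDiffVectorBundle ∞ F V 𝓘(ℝ, E)]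
    (cov : CovariantDerivative 𝓘(ℝ, E) F V) (hcov : cov.ContMDiffCovariantDerivative ∞)
    (𝒥 : GenGeom.GACS (𝓘(ℝ, E).prod 𝓘(ℝ, F)) (E × F)
      (TangentSpace (𝓘(ℝ, E).prod 𝓘(ℝ, F)) : TotalSpace F V → Type _))
    (hsf : GenGeom.IsSemiFlat cov 𝒥) (hint : 𝒥.IsIntegrable) :
    ∃ J : GenGeom.GACS 𝓘(ℝ, E) (F × E) (GenGeom.VT E V),
      (GenGeom.IsLiftOf cov 𝒥 J ∧ ∀ J', GenGeom.IsLiftOf cov 𝒥 J' → J' = J) ∧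
      GenGeom.IsAdapted J ∧
      GenGeom.IsDirac 𝓘(ℝ, E) (GenGeom.diracV J) ∧
      GenGeom.IsDirac 𝓘(ℝ, E) (GenGeom.diracVDual J) ∧
      (∀ x, IsCompl (GenGeom.diracV J x) (GenGeom.diracVDual J x)) ∧
      (∃ D : GenGeom.SubbundleConnection 𝓘(ℝ, E) (GenGeom.diracV J),
        D.IsFlat ∧
        ∀ (U : Set M) (s : Π x, V x), IsOpen U → GenGeom.SmoothOn 𝓘(ℝ, E) F U s →
          ∀ x ∈ U, ∀ v : TangentSpace 𝓘(ℝ, E) x,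
            D.toFun (fun y ↦ GenGeom.baseMap J y (s y, 0)) x v =
              GenGeom.baseMap J x (cov s x v, 0)) ∧
      (∃ D : GenGeom.SubbundleConnection 𝓘(ℝ, E) (GenGeom.diracVDual J),
        D.IsFlat ∧
        ∀ (U : Set M) (ξ : Π x, V x →L[ℝ] ℝ), IsOpen U → GenGeom.DualSmoothOn 𝓘(ℝ, E) F U ξ →
          ∀ x ∈ U, ∀ v : TangentSpace 𝓘(ℝ, E) x,
            D.toFun (fun y ↦ GenGeom.baseMap J y (0, ξ y)) x v =
              GenGeom.baseMap J x (0, GenGeom.dualCov cov ξ x v)) := by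
  simpa only [hsf.1, true_imp_iff] using mainTheorem6_general cov hcov 𝒥 hsf.2 hint
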